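/- **Setting.** Let $\mathbb I=[a,b]\subset\mathbb R$ be a compact interval, $d\in\mathbb N$, and $(\Omega,\mathscr F,\mathbb P)$ a probability space. A *continuous process* in $\mathbb R^d$ is a family $Y=(Y_t)_{t\in\mathbb I}$ of $\mathbb R^d$-valued random vectors with continuous sample paths; it is *IC* if its coordinate processes $Y^1,\dots,Y^d$ are mutually independent (as random paths). Its *spatial support* is $D_Y=\overline{\bigcup_{t\in\mathbb I}\operatorname{supp}(\mathbb P_{Y_t})}$. A map $\varphi:\mathbb R^d\to\mathbb R^d$ is *$C^k$-invertible* on an open set $G$ if $\varphi|_G$ is a $C^k$-diffeomorphism onto an open set $\varphi(G)$. **Monomial maps.** A map $\varrho:\mathbb R^d\to\mathbb R^d$ is *monomial on* $G\subseteq\mathbb R^d$, written $\varrho\in\mathrm{DP}_d(G)$, if on each connected component $C$ of $G$ one has $\varrho|_C=P\circ(h_1\times\cdots\times h_d)$ for a permutation matrix $P$ and maps $h_i:\pi_i(C)\to\mathbb R$ which are $C^1$-diffeomorphisms onto their images (a void condition if $\pi_i(C)$ is a point), $\pi_i$ being the $i$-th coordinate projection. For paths $x,y:\mathbb I\to\mathbb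 R^d$, write $y\in\mathrm{DP}_d\cdot x$ if $y_t=\varrho(x_t)$ for all $t\in\mathbb I$, for some $\varrho$ that is monomial on the trace $\{x_t\mid t\in\mathbb I\}$. **Non-degenerate densities.** Let $G\subseteq\mathbb R^2$ be open. A function $\varsigma$ is *pseudo-Gaussian* on $G$ if there are $\varsigma_1,\varsigma_2,\varsigma_3:\mathbb R\to\mathbb R$ and a sign $\epsilon\in\{\pm1\}$ with $\varsigma(x,y)=\varsigma_1(x)\varsigma_2(y)\exp(\epsilon\,\varsigma_3(x)\varsigma_3(y))$ on $G$, and *separable* on $G$ if this holds with $\varsigma_3\equiv0$. It is *a.e. non-Gaussian* (resp. *a.e. non-separable*) on $G$ if there is a relatively closed Lebesgue nullset $N\subset G$ such that $\varsigma$ is pseudo-Gaussian (resp. separable) on no nonempty open subset of $G\setminus N$. For $U\subseteq\mathbb R$ open, $\varsigma$ is *regularly non-separable* on $U\times U$ if it is $C^2$, positive and a.e. non-separable on $U\times U$, and $\partial_x\partial_y\log\varsigma(x,x)\neq0$ for almost every $x\in U$. **$\alpha$-contrastive.** A continuous process $S$ is *$\alpha$-contrastive* if it is IC and there are a set $\mathcal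 P\subseteq\{(s,t)\in\mathbb I^2\mid s<t\}$ and open sets $D_{\mathfrak p}\subseteq\mathbb R^d$, $\mathfrak p\in\mathcal P$, such that $\bigcup_{\mathfrak p\in\mathcal P}D_{\mathfrak p}$ is a dense subset of $D_S$ and, for each $\mathfrak p=(s,t)\in\mathcal P$: for every $i$, $(S^i_s,S^i_t)$ has a Lebesgue density $\zeta^i_{s,t}$ which is $C^2$ on the interior of its support and regularly non-separable on $\pi_i(D_{\mathfrak p})\times\pi_i(D_{\mathfrak p})$; and for all but at most one $i$, $\zeta^i_{s,t}$ is a.e. non-Gaussian on $\pi_i(D_{\mathfrak p})\times\pi_i(D_{\mathfrak p})$. **Theorem.** Let $S$ and $X$ be continuous processes in $\mathbb R^d$ with $X=f(S)$ almost surely, where $f$ is $C^3$-invertible on some open superset of $D_S$, and let $S$ be $\alpha$-contrastive. Let $h$ be $C^3$-invertible on some open superset of $D_X$, and write $h\cdot X=(h(X_t))_{t\in\mathbb I}$. 1. If $D_S$ is convex (for instance $D_S=\mathbb R^d$), then $$\text{there is } \varrho\in\mathrm{DP}_d(D_S) \text{ such that, with probability one, } h(X_t)=\varrho(S_t) \text{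 for all } t\in\mathbb I$$ if and only if $h\cdot X$ has independent coordinate processes. 2. If $h\cdot X$ has independent coordinate processes, then, for arbitrary $D_S$, the map $h\circ f$ is monomial on every convex subset of $D_S$. If moreover each connected component of $D_S$ is convex, then $h\circ f\in\mathrm{DP}_d(D_S)$ and, with probability one, $h\cdot X\in\mathrm{DP}_d\cdot S$. 3. If $D_S$ is connected and there is $\varrho\in\mathrm{DP}_d(D_S)$ such that, with probability one, $h(X_t)=\varrho(S_t)$ for all $t\in\mathbb I$, then $h\cdot X$ has independent coordinate processes. -/

import Mathlib

open MeasureTheory ProbabilityTheory Set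

namespace NonlinearICA

/-- A continuous stochastic process in `ℝ^d` over the compact interval `[a, b]`: a family of
random vectors all of whose sample paths are continuous. (Only the topology, the smooth structure
and Lebesgue measure of `ℝ^d` are used, so the choice of a norm on it is immaterial.) -/
structure IsContinuousProcess {Ω : Type*} [MeasurableSpace Ω] {d : ℕ} {a b : ℝ}
    (Y : Icc a b → Ω → Fin d → ℝ) : Prop where
  measurable : ∀ t, Measurable (Y t)
  continuous_path : ∀ ω, Continuous fun t => Y t ω

/-- `Y` is IC: its coordinate processes are mutually independent, as random elements of the path
space with the σ-algebra generated by the evaluations. -/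
def IsIC {Ω : Type*} [MeasurableSpace Ω] (μ : Measure Ω) {T : Type*} {d : ℕ}
    (Y : T → Ω → Fin d → ℝ) : Prop :=
  iIndepFun (fun (i : Fin d) (ω : Ω) (t : T) => Y t ω i) μ

/-- The spatial support of a process: the closure of the union over all times `t` of the support
of the law of `Y t`. -/
def spatialSupport {Ω : Type*} [MeasurableSpace Ω] (μ : Measure Ω) {T : Type*} {d : ℕ}
    (Y : T → Ω → Fin d → ℝ) : Set (Fin d → ℝ) :=
  closure (⋃ t, (μ.map (Y t)).support)

/-- `φ` restricts to a `C^k`-diffeomorphism from `G` onto `φ '' G`. -/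
def IsDiffeoOn {E F : Type*} [NormedAddCommGroup E] [NormedSpace ℝ E] [NormedAddCommGroup F]
    [NormedSpace ℝ F] (k : ℕ) (φ : E → F) (G : Set E) : Prop :=
  ContDiffOn ℝ k φ G ∧ ∃ ψ : F → E, ContDiffOn ℝ k ψ (φ '' G) ∧ LeftInvOn ψ φ G

/-- `φ` is `C^k`-invertible on the open set `G`. -/
def IsInvertibleOn {d : ℕ} (k : ℕ) (φ : (Fin d → ℝ) → Fin d → ℝ) (G : Set (Fin d → ℝ)) : Prop :=
  IsOpen G ∧ IsOpen (φ '' G) ∧ IsDiffeoOn k φ G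

/-- `ϱ` is monomial on `G` (`ϱ ∈ DP_d(G)`): on each connected component `C` of `G`, it is a
permutation of coordinates composed with a product `h₁ × ⋯ × h_d` of `C^1`-diffeomorphisms `h_i`
of the intervals `π_i(C)` onto their images. If `π_i(C)` is a single point, then the
differentiability condition on `h_i` is void. -/
def IsMonomialOn {d : ℕ} (ϱ : (Fin d → ℝ) → Fin d → ℝ) (G : Set (Fin d → ℝ)) : Prop :=
  ∀ x ∈ G, ∃ (σ : Equiv.Perm (Fin d)) (h : Fin d → ℝ → ℝ),
    (∀ i, IsDiffeoOn 1 (h i) ((fun y : Fin d → ℝ => y i) '' connectedComponentIn G x)) ∧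
    ∀ y ∈ connectedComponentIn G x, ∀ i, ϱ y i = h (σ i) (y (σ i))

/-- The path `y` coincides with the path `x` up to a permutation and monotone scaling of
coordinates (`y ∈ DP_d · x`): `y = ϱ ∘ x` for some `ϱ` that is monomial on the trace of `x`. -/
def InMonomialOrbit {T : Type*} {d : ℕ} (y x : T → Fin d → ℝ) : Prop :=
  ∃ ϱ : (Fin d → ℝ) → Fin d → ℝ, IsMonomialOn ϱ (range x) ∧ ∀ t, y t = ϱ (x t)

/-- `ς` is pseudo-Gaussian on `G`; the sign is the same on all of `G`. -/
def IsPseudoGaussianOn (ς : ℝ × ℝ → ℝ) (G : Set (ℝ × ℝ)) : Prop :=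
  ∃ ς₁ ς₂ ς₃ : ℝ → ℝ,
    (∀ p ∈ G, ς p = ς₁ p.1 * ς₂ p.2 * Real.exp (ς₃ p.1 * ς₃ p.2)) ∨
    (∀ p ∈ G, ς p = ς₁ p.1 * ς₂ p.2 * Real.exp (-(ς₃ p.1 * ς₃ p.2)))

/-- `ς` is separable on `G`. -/
def IsSeparableOn (ς : ℝ × ℝ → ℝ) (G : Set (ℝ × ℝ)) : Prop :=
  ∃ ς₁ ς₂ : ℝ → ℝ, ∀ p ∈ G, ς p = ς₁ p.1 * ς₂ p.2

/-- `ς` strictly fails the property `P` on `G`: it has `P` on no nonempty open subset of `G`. -/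
def StrictlyNotOn (P : (ℝ × ℝ → ℝ) → Set (ℝ × ℝ) → Prop) (ς : ℝ × ℝ → ℝ)
    (G : Set (ℝ × ℝ)) : Prop :=
  ∀ O ⊆ G, IsOpen O → O.Nonempty → ¬ P ς O

/-- `ς` fails the property `P` almost everywhere on the open set `G`: off a relatively closed
nullset of `G`, it strictly fails `P`. -/
def AENotOn (P : (ℝ × ℝ → ℝ) → Set (ℝ × ℝ) → Prop) (ς : ℝ × ℝ → ℝ)
    (G : Set (ℝ × ℝ)) : Prop :=
  ∃ N ⊆ G, IsOpen (G \ N) ∧ volume N = 0 ∧ StrictlyNotOn P ς (G \ N)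

/-- The mixed logarithmic derivative `∂_x ∂_y log ς`. -/
noncomputable def mixedLogDeriv (ς : ℝ × ℝ → ℝ) (p : ℝ × ℝ) : ℝ :=
  deriv (fun x => deriv (fun y => Real.log (ς (x, y))) p.2) p.1

/-- `ς` is regularly non-separable on `U × U`, for `U ⊆ ℝ` open: it is a positive `C^2`-function
there, a.e. non-separable, and its mixed logarithmic derivative is nonzero a.e. on the diagonal. -/
def IsRegularlyNonSeparable (ς : ℝ × ℝ → ℝ) (U : Set ℝ) : Prop :=
  ContDiffOn ℝ 2 ς (U ×ˢ U) ∧ (∀ p ∈ U ×ˢ U, 0 < ς p) ∧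
    AENotOn IsSeparableOn ς (U ×ˢ U) ∧
    ∀ᵐ x : ℝ, x ∈ U → mixedLogDeriv ς (x, x) ≠ 0

/-- `ς` is a Lebesgue density of the law of the random vector `Z` in `ℝ^2`. -/
def IsDensityOf {Ω : Type*} [MeasurableSpace Ω] (μ : Measure Ω) (Z : Ω → ℝ × ℝ)
    (ς : ℝ × ℝ → ℝ) : Prop :=
  Measurable ς ∧ (∀ p, 0 ≤ ς p) ∧ μ.map Z = volume.withDensity fun p => ENNReal.ofReal (ς p)

/-- The continuous process `S` is `α`-contrastive. As `(u, v)` runs through `D × D`, the pair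
`(u i, v i)` runs through `π_i(D) × π_i(D)`, so the conditions on the restriction to `D × D` of the
density `ζ i` of `(S^i_s, S^i_t)` are conditions on `π_i(D) × π_i(D)`. -/
def IsAlphaContrastive {Ω : Type*} [MeasurableSpace Ω] (μ : Measure Ω) {d : ℕ} {a b : ℝ}
    (S : Icc a b → Ω → Fin d → ℝ) : Prop :=
  IsContinuousProcess S ∧ IsIC μ S ∧
  ∃ (P : Set (Icc a b × Icc a b)) (D : Icc a b × Icc a b → Set (Fin d → ℝ)),
    (∀ p ∈ P, p.1 < p.2 ∧ IsOpen (D p)) ∧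
    (⋃ p ∈ P, D p) ⊆ spatialSupport μ S ∧
    spatialSupport μ S ⊆ closure (⋃ p ∈ P, D p) ∧
    ∀ p ∈ P, ∃ ζ : Fin d → ℝ × ℝ → ℝ,
      (∀ i, IsDensityOf μ (fun ω => (S p.1 ω i, S p.2 ω i)) (ζ i) ∧
        ContDiffOn ℝ 2 (ζ i) (interior (tsupport (ζ i))) ∧
        IsRegularlyNonSeparable (ζ i) ((fun u : Fin d → ℝ => u i) '' D p)) ∧
      {i | ¬ AENotOn IsPseudoGaussianOn (ζ i)
        (((fun u : Fin d → ℝ => u i) '' D p) ×ˢ ((fun u : Fin d → ℝ => u i) '' D p))}.Subsingleton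

end NonlinearICA

namespace NonlinearICA

/-! Put `g = h ∘ f` and `Y = h · X = g(S)`, and suppose that `Y` is IC. For a pair of times `(s, t)`
the joint density of `(S_s, S_t)` at `(x, y)` is `Z(x, y) = ∏ ζ_k(x_k, y_k)`. Independence of the
coordinates of `Y` gives `Z(x, y) Z(x', y') = Z(x', y) Z(x, y')` whenever, for each `k`, either
`g_k(x) = g_k(x')` or `g_k(y) = g_k(y')` (`pairDensity_mul_pairDensity`). The Jacobian determinants
of a change of variables would cancel in this cross-ratio, so small preimages of boxes suffice to
prove it.

Moving `x` along the `i`-th and `y` along the `j`-th coordinate of `g`, `i ≠ j`, and differentiating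
`log Z` shows that `B(x)ᵀ Q(x, y) B(y)` is diagonal, where `B` is the Jacobian matrix of the inverse
of `g` and `Q = diag(q_k(x_k, y_k))` with `q_k = ∂_x ∂_y log ζ_k` (`isDiag_of_pairDensity_mul`).
Used at `(x, x)`, `(x, y)` and `(y, y)`, this leaves at most one nonzero entry in each row of the
Jacobian matrix of `g` at `x`, provided that the ratios `q_k(x_k, y_k)² / (q_k(x_k, x_k) q_k(y_k,
y_k))` differ for different `k` (`mul_eq_zero_of_isDiag`). A locally constant ratio would make `ζ_k`
pseudo-Gaussian, so all but at most one `k` offer infinitely many ratios near any point, and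
distinct ones can be chosen.

The row condition is closed and hence spreads to all of `D_S`. On a convex set the position of the
nonzero entry is constant, and integration along segments makes `g` monomial. The converse holds
because a monomial map acts on independent coordinate paths separately. -/

/-! ### Linear algebra and combinatorics -/

/-- If `Bxᵀ Q Bx`, `Bxᵀ Q' By`, `Byᵀ Q'' By` are all diagonal, for diagonal matrices `Q`, `Q'`, `Q''`
such that `Q'² / (Q Q'')` has pairwise distinct entries, then the inverse of `Bx` has at most one
nonzero entry in each row. -/
theorem mul_eq_zero_of_isDiag {n : Type*} [Fintype n] [DecidableEq n]
    {Ax Bx Ay By : Matrix n n ℝ} (hx : Ax * Bx = 1) (hy : Ay * By = 1) {qxx qxy qyy : n → ℝ}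
    (hqxx : ∀ k, qxx k ≠ 0) (hqyy : ∀ k, qyy k ≠ 0)
    (hxx : (Bx.transpose * Matrix.diagonal qxx * Bx).IsDiag)
    (hxy : (Bx.transpose * Matrix.diagonal qxy * By).IsDiag)
    (hyy : (By.transpose * Matrix.diagonal qyy * By).IsDiag)
    (hinj : Function.Injective fun k => qxy k ^ 2 / (qxx k * qyy k))
    (i : n) {j k : n} (hjk : j ≠ k) : Ax i j * Ax i k = 0 := by
  -- If `Bᵀ Q B' = Λ` is diagonal and `A = B⁻¹`, then `Q B' = Aᵀ Λ`.
  have key : ∀ {A B B' : Matrix n n ℝ} {q : n → ℝ}, A * B = 1 →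
      (B.transpose * Matrix.diagonal q * B').IsDiag →
      ∃ l : n → ℝ, ∀ k i, q k * B' k i = A i k * l i := by
    intro A B B' q hAB hD
    refine ⟨Matrix.diag (B.transpose * Matrix.diagonal q * B'), fun k i => ?_⟩
    have h1 : A.transpose * (B.transpose * Matrix.diagonal q * B') = Matrix.diagonal q * B' := by
      rw [← Matrix.mul_assoc, ← Matrix.mul_assoc, ← Matrix.transpose_mul,
        mul_eq_one_comm.1 hAB, Matrix.transpose_one, Matrix.one_mul]
    rw [← hD.diagonal_diag] at h1
    have h2 := congrFun (congrFun h1 k) i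
    rw [Matrix.mul_diagonal, Matrix.diagonal_mul, Matrix.transpose_apply] at h2
    exact h2.symm
  have hyx : (By.transpose * Matrix.diagonal qxy * Bx).IsDiag := by
    have := hxy.transpose
    rwa [Matrix.transpose_mul, Matrix.transpose_mul, Matrix.transpose_transpose,
      Matrix.diagonal_transpose, ← Matrix.mul_assoc] at this
  -- A vanishing multiplier `l i` would kill the `i`-th column of the invertible matrix `B`.
  have hl0 : ∀ {A B : Matrix n n ℝ} {q l : n → ℝ}, A * B = 1 → (∀ k, q k ≠ 0) →
      (∀ k i, q k * B k i = A i k * l i) → ∀ i, l i ≠ 0 := by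
    intro A B q l hAB hq h i hi
    have hB : ∀ k, B k i = 0 := fun k => by
      have := h k i
      rw [hi, mul_zero] at this
      exact (mul_eq_zero.1 this).resolve_left (hq k)
    have := congrFun (congrFun hAB i) i
    rw [Matrix.mul_apply, Matrix.one_apply_eq] at this
    simp [hB] at this
  obtain ⟨lxx, h1⟩ := key hx hxx
  obtain ⟨lyy, h2⟩ := key hy hyy
  obtain ⟨lxy, h3⟩ := key hx hxy
  obtain ⟨lyx, h4⟩ := key hy hyx
  have hlyx : ∀ i, lyx i = lxy i := by
    intro i
    have e1 := congrFun (congrFun hx i) i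
    have e2 := congrFun (congrFun hy i) i
    rw [Matrix.mul_apply, Matrix.one_apply_eq] at e1 e2
    calc lyx i = ∑ k, (Ay i k * lyx i) * By k i := by
          conv_lhs => rw [← mul_one (lyx i), ← e2, Finset.mul_sum]
          exact Finset.sum_congr rfl fun k _ => by ring
      _ = ∑ k, (Ax i k * lxy i) * Bx k i :=
          Finset.sum_congr rfl fun k _ => by rw [← h3, ← h4]; ring
      _ = lxy i := by
          conv_rhs => rw [← mul_one (lxy i), ← e1, Finset.mul_sum]
          exact Finset.sum_congr rfl fun k _ => by ring
  have hxx0 := hl0 hx hqxx h1 i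
  have hyy0 := hl0 hy hqyy h2 i
  -- Eliminating the entries of `Bx`, `By` and `Ay` from the four relations leaves the ratio at `k`
  -- equal to a number that depends on `i` only, wherever `Ax i k ≠ 0`.
  have main : ∀ k, Ax i k ≠ 0 →
      qxy k ^ 2 / (qxx k * qyy k) = lxy i ^ 2 / (lxx i * lyy i) := by
    intro k hk
    have a1 := h1 k i
    have a2 := h2 k i
    have a3 := h3 k i
    have a4 := h4 k i
    rw [hlyx] at a4
    have e : Ax i k * (qxy k ^ 2 * (lxx i * lyy i)) = Ax i k * (lxy i ^ 2 * (qxx k * qyy k)) := by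
      linear_combination (-qxy k ^ 2 * lyy i) * a1 + (qxx k * qxy k * lyy i) * a4
        - (qxx k * qxy k * lxy i) * a2 + qxx k * qyy k * lxy i * a3
    rw [div_eq_div_iff (mul_ne_zero (hqxx k) (hqyy k)) (mul_ne_zero hxx0 hyy0)]
    exact mul_left_cancel₀ hk e
  by_contra h0
  obtain ⟨hj, hk⟩ := mul_ne_zero_iff.1 h0
  exact hjk (hinj ((main j hj).trans (main k hk).symm))

/-- Greedy choice: the possibly finite set chooses first, and every infinite set can then avoid the
finitely many values already taken. It supplies the pairwise distinct ratios that
`mul_eq_zero_of_isDiag` needs. -/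
theorem exists_injective_mem {n α : Type*} [Fintype n] [DecidableEq n] (W : n → Set α)
    (hne : ∀ k, (W k).Nonempty) (hinf : {k | ¬ (W k).Infinite}.Subsingleton) :
    ∃ w : n → α, Function.Injective w ∧ ∀ k, w k ∈ W k := by
  classical
  -- The forbidden finite set `F` is part of the induction, since it grows by one chosen value at
  -- each step.
  have key : ∀ (s : Finset n) (F : Set α), F.Finite → (∀ k ∈ s, (W k).Infinite) →
      ∃ w : n → α, InjOn w s ∧ ∀ k ∈ s, w k ∈ W k \ F := by
    intro s
    induction s using Finset.induction_on with
    | empty => exact fun F _ _ => ⟨fun k => (hne k).some, by simp, by simp⟩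
    | insert a s ha ih =>
      intro F hF hs
      obtain ⟨u, hu⟩ := ((hs a (Finset.mem_insert_self a s)).sdiff hF).nonempty
      obtain ⟨w, hw, hw'⟩ := ih (insert u F) (hF.insert u)
        fun k hk => hs k (Finset.mem_insert_of_mem hk)
      have hne' : ∀ k ∈ s, k ≠ a := fun k hk h => ha (h ▸ hk)
      refine ⟨Function.update w a u, ?_, ?_⟩
      · intro k hk l hl hkl
        simp only [Finset.coe_insert, mem_insert_iff, Finset.mem_coe] at hk hl
        rcases hk with rfl | hk <;> rcases hl with rfl | hl
        · rfl
        · rw [Function.update_self, Function.update_of_ne (hne' l hl)] at hkl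
          exact absurd (hkl ▸ mem_insert _ _) (hw' l hl).2
        · rw [Function.update_self, Function.update_of_ne (hne' k hk)] at hkl
          exact absurd (hkl ▸ mem_insert _ _) (hw' k hk).2
        · rw [Function.update_of_ne (hne' k hk), Function.update_of_ne (hne' l hl)] at hkl
          exact hw hk hl hkl
      · intro k hk
        rcases Finset.mem_insert.1 hk with rfl | hk
        · rwa [Function.update_self]
        · rw [Function.update_of_ne (hne' k hk)]
          exact ⟨(hw' k hk).1, fun h => (hw' k hk).2 (mem_insert_of_mem _ h)⟩
  by_cases hex : ∃ k₀, ¬ (W k₀).Infinite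
  · obtain ⟨k₀, hk₀⟩ := hex
    obtain ⟨w₀, hw₀⟩ := hne k₀
    obtain ⟨w, hw, hw'⟩ := key (Finset.univ.erase k₀) {w₀} (finite_singleton _) fun k hk => by
      by_contra h
      exact (Finset.ne_of_mem_erase hk) (hinf h hk₀)
    have hm : ∀ {k}, k ≠ k₀ → k ∈ Finset.univ.erase k₀ := fun h =>
      Finset.mem_erase.2 ⟨h, Finset.mem_univ _⟩
    refine ⟨Function.update w k₀ w₀, ?_, ?_⟩
    · intro k l hkl
      by_cases hk : k = k₀ <;> by_cases hl : l = k₀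
      · rw [hk, hl]
      · subst hk
        rw [Function.update_self, Function.update_of_ne hl] at hkl
        exact absurd hkl.symm (hw' l (hm hl)).2
      · subst hl
        rw [Function.update_self, Function.update_of_ne hk] at hkl
        exact absurd hkl (hw' k (hm hk)).2
      · rw [Function.update_of_ne hk, Function.update_of_ne hl] at hkl
        exact hw (hm hk) (hm hl) hkl
    · intro k
      by_cases hk : k = k₀
      · subst hk; rwa [Function.update_self]
      · rw [Function.update_of_ne hk]
        exact (hw' k (hm hk)).1
  · push Not at hex
    obtain ⟨w, hw, hw'⟩ := key Finset.univ ∅ finite_empty fun k _ => hex k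
    exact ⟨w, fun k l => hw (by simp) (by simp), fun k => (hw' k (Finset.mem_univ k)).1⟩

/-! ### Mixed logarithmic derivatives -/

/-- The partial logarithmic derivative `∂_y log ς`. -/
noncomputable def logPartial (ς : ℝ × ℝ → ℝ) (p : ℝ × ℝ) : ℝ :=
  fderiv ℝ (fun p => Real.log (ς p)) p (0, 1)

section
variable {ς : ℝ × ℝ → ℝ} {G : Set (ℝ × ℝ)}

theorem contDiffOn_log (h : ContDiffOn ℝ 2 ς G) (hpos : ∀ p ∈ G, 0 < ς p) :
    ContDiffOn ℝ 2 (fun p => Real.log (ς p)) G :=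
  h.log fun p hp => (hpos p hp).ne'

theorem contDiffOn_logPartial (hG : IsOpen G) (h : ContDiffOn ℝ 2 ς G)
    (hpos : ∀ p ∈ G, 0 < ς p) : ContDiffOn ℝ 1 (logPartial ς) G :=
  ((contDiffOn_log h hpos).fderiv_of_isOpen hG (by norm_num)).clm_apply contDiffOn_const

theorem hasDerivAt_log_snd (hG : IsOpen G) (h : ContDiffOn ℝ 2 ς G)
    (hpos : ∀ p ∈ G, 0 < ς p) {p : ℝ × ℝ} (hp : p ∈ G) :
    HasDerivAt (fun y => Real.log (ς (p.1, y))) (logPartial ς p) p.2 := by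
  have h1 : HasFDerivAt (fun p => Real.log (ς p)) _ p :=
    (((contDiffOn_log h hpos).contDiffAt (hG.mem_nhds hp)).differentiableAt
      (by norm_num)).hasFDerivAt
  have h2 : HasDerivAt (fun y : ℝ => (p.1, y)) ((0 : ℝ), (1 : ℝ)) p.2 :=
    (hasDerivAt_const _ _).prodMk (hasDerivAt_id _)
  exact h1.comp_hasDerivAt (f := fun y : ℝ => (p.1, y)) p.2 h2

theorem hasDerivAt_logPartial_fst (hG : IsOpen G) (h : ContDiffOn ℝ 2 ς G)
    (hpos : ∀ p ∈ G, 0 < ς p) {p : ℝ × ℝ} (hp : p ∈ G) :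
    HasDerivAt (fun x => logPartial ς (x, p.2)) (fderiv ℝ (logPartial ς) p (1, 0)) p.1 := by
  have h1 : HasFDerivAt (logPartial ς) _ p :=
    (((contDiffOn_logPartial hG h hpos).contDiffAt (hG.mem_nhds hp)).differentiableAt
      (by norm_num)).hasFDerivAt
  have h2 : HasDerivAt (fun x : ℝ => (x, p.2)) ((1 : ℝ), (0 : ℝ)) p.1 :=
    (hasDerivAt_id _).prodMk (hasDerivAt_const _ _)
  exact h1.comp_hasDerivAt (f := fun x : ℝ => (x, p.2)) p.1 h2

theorem mixedLogDeriv_eq (hG : IsOpen G) (h : ContDiffOn ℝ 2 ς G)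
    (hpos : ∀ p ∈ G, 0 < ς p) {p : ℝ × ℝ} (hp : p ∈ G) :
    mixedLogDeriv ς p = fderiv ℝ (logPartial ς) p (1, 0) := by
  rw [← (hasDerivAt_logPartial_fst hG h hpos hp).deriv, mixedLogDeriv]
  apply Filter.EventuallyEq.deriv_eq
  have hc : Continuous fun x : ℝ => (x, p.2) := by fun_prop
  filter_upwards [(hG.preimage hc).mem_nhds (show p.1 ∈ _ from hp)] with x hx
  exact (hasDerivAt_log_snd hG h hpos hx).deriv

theorem hasDerivAt_logPartial (hG : IsOpen G) (h : ContDiffOn ℝ 2 ς G)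
    (hpos : ∀ p ∈ G, 0 < ς p) {p : ℝ × ℝ} (hp : p ∈ G) :
    HasDerivAt (fun x => logPartial ς (x, p.2)) (mixedLogDeriv ς p) p.1 := by
  rw [mixedLogDeriv_eq hG h hpos hp]
  exact hasDerivAt_logPartial_fst hG h hpos hp

theorem continuousOn_mixedLogDeriv (hG : IsOpen G) (h : ContDiffOn ℝ 2 ς G)
    (hpos : ∀ p ∈ G, 0 < ς p) : ContinuousOn (mixedLogDeriv ς) G := by
  have h1 : ContinuousOn (fderiv ℝ (logPartial ς)) G :=
    (contDiffOn_logPartial hG h hpos).continuousOn_fderiv_of_isOpen hG (by norm_num)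
  exact (h1.clm_apply continuousOn_const).congr fun p hp => mixedLogDeriv_eq hG h hpos hp

end

/-- A density whose mixed logarithmic derivative `q` satisfies `q(x,y)² = q(x,x) q(y,y) ≠ 0` on the
square over an interval is pseudo-Gaussian there. -/
theorem isPseudoGaussianOn_of_sq_eq {ς : ℝ × ℝ → ℝ} {V : Set ℝ} (hV : IsOpen V)
    (hVc : IsPreconnected V) (hς : ContDiffOn ℝ 2 ς (V ×ˢ V)) (hpos : ∀ p ∈ V ×ˢ V, 0 < ς p)
    (hq : ∀ p ∈ V ×ˢ V, mixedLogDeriv ς p ≠ 0)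
    (hsq : ∀ x ∈ V, ∀ y ∈ V,
      mixedLogDeriv ς (x, y) ^ 2 = mixedLogDeriv ς (x, x) * mixedLogDeriv ς (y, y)) :
    IsPseudoGaussianOn ς (V ×ˢ V) := by
  rcases V.eq_empty_or_nonempty with rfl | ⟨c, hc⟩
  · exact ⟨0, 0, 0, Or.inl (by simp)⟩
  have hG : IsOpen (V ×ˢ V) := hV.prod hV
  set q := mixedLogDeriv ς with hqdef
  have hcont : ContinuousOn q (V ×ˢ V) := continuousOn_mixedLogDeriv hG hς hpos
  -- By connectedness `q` has constant sign, which allows square roots to be taken in `hsq`.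
  have hsign : ∀ p ∈ V ×ˢ V, ∀ p' ∈ V ×ˢ V, 0 < q p * q p' := by
    intro p hp p' hp'
    by_contra hneg
    have hpc : IsPreconnected (V ×ˢ V) := hVc.prod hVc
    have h1 := hpc.intermediate_value hp hp' hcont
    have h2 := hpc.intermediate_value hp' hp hcont
    have h0 : (0 : ℝ) ∈ q '' (V ×ˢ V) := by
      rcases lt_or_gt_of_ne (hq p hp) with h | h <;> rcases lt_or_gt_of_ne (hq p' hp') with h' | h'
      · exact absurd (mul_pos_of_neg_of_neg h h') hneg
      · exact h1 ⟨h.le, h'.le⟩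
      · exact h2 ⟨h'.le, h.le⟩
      · exact absurd (mul_pos h h') hneg
    obtain ⟨z, hz, hz0⟩ := h0
    exact hq z hz hz0
  have hcc : (c, c) ∈ V ×ˢ V := ⟨hc, hc⟩
  have hq0 := hq _ hcc
  have hform : ∀ x ∈ V, ∀ y ∈ V, q (x, y) = (q (c, c))⁻¹ * q (x, c) * q (y, c) := by
    intro x hx y hy
    have hxc : (x, c) ∈ V ×ˢ V := ⟨hx, hc⟩
    have hyc : (y, c) ∈ V ×ˢ V := ⟨hy, hc⟩
    have s1 := hsign _ (show (x, y) ∈ V ×ˢ V from ⟨hx, hy⟩) _ hcc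
    have s2 := hsign _ hxc _ hyc
    have e : (q (x, y) * q (c, c)) ^ 2 = (q (x, c) * q (y, c)) ^ 2 := by
      rw [mul_pow, mul_pow, hsq x hx y hy, hsq x hx c hc, hsq y hy c hc]; ring
    have e' : q (x, y) * q (c, c) = q (x, c) * q (y, c) :=
      (pow_left_inj₀ s1.le s2.le two_ne_zero).1 e
    field_simp
    linarith
  -- Since `m` is an antiderivative of `q(·, c)`, the rank-one form of `q` integrates explicitly, in
  -- `x` (`step1`) and then in `y` (`step2`).
  set m : ℝ → ℝ := fun x => logPartial ς (x, c) with hm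
  have hmd : ∀ x ∈ V, HasDerivAt m (q (x, c)) x := fun x hx =>
    hasDerivAt_logPartial hG hς hpos (p := (x, c)) ⟨hx, hc⟩
  set κ := (q (c, c))⁻¹ with hκ
  have step1 : ∀ x ∈ V, ∀ y ∈ V,
      logPartial ς (x, y) - logPartial ς (c, y) = κ * (m x - m c) * q (y, c) := by
    intro x hx y hy
    have hd : ∀ z ∈ V, HasDerivAt (fun z => logPartial ς (z, y) - κ * (m z) * q (y, c)) 0 z := by
      intro z hz
      have := (hasDerivAt_logPartial hG hς hpos (p := (z, y)) ⟨hz, hy⟩).sub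
        (((hmd z hz).const_mul κ).mul_const (q (y, c)))
      rwa [← hqdef, hform z hz y hy, sub_self] at this
    have := hV.is_const_of_deriv_eq_zero hVc
      (fun z hz => (hd z hz).differentiableAt.differentiableWithinAt)
      (fun z hz => (hd z hz).deriv) hx hc
    linear_combination this
  have step2 : ∀ x ∈ V, ∀ y ∈ V, Real.log (ς (x, y)) =
      Real.log (ς (x, c)) + Real.log (ς (c, y)) - Real.log (ς (c, c))
        + κ * ((m x - m c) * (m y - m c)) := by
    intro x hx y hy
    have hd : ∀ z ∈ V, HasDerivAt (fun z => Real.log (ς (x, z)) - Real.log (ς (c, z))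
        - κ * (m x - m c) * m z) 0 z := by
      intro z hz
      have := ((hasDerivAt_log_snd hG hς hpos (p := (x, z)) ⟨hx, hz⟩).sub
        (hasDerivAt_log_snd hG hς hpos (p := (c, z)) ⟨hc, hz⟩)).sub
        ((hmd z hz).const_mul (κ * (m x - m c)))
      rwa [step1 x hx z hz, sub_self] at this
    have := hV.is_const_of_deriv_eq_zero hVc
      (fun z hz => (hd z hz).differentiableAt.differentiableWithinAt)
      (fun z hz => (hd z hz).deriv) hy hc
    linear_combination this
  have hexp : ∀ p ∈ V ×ˢ V, ς p = ς (p.1, c) * (ς (c, p.2) / ς (c, c)) *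
      Real.exp (κ * ((m p.1 - m c) * (m p.2 - m c))) := by
    rintro ⟨x, y⟩ ⟨hx, hy⟩
    have p1 := hpos (x, c) ⟨hx, hc⟩
    have p2 := hpos (c, y) ⟨hc, hy⟩
    have p3 := hpos (c, c) hcc
    rw [← Real.exp_log (hpos (x, y) ⟨hx, hy⟩), step2 x hx y hy, Real.exp_add, Real.exp_sub,
      Real.exp_add, Real.exp_log p1, Real.exp_log p2, Real.exp_log p3, mul_div_assoc]
  -- The factor `√|κ|` splits the constant evenly between the two variables; the sign of `κ` becomes
  -- the sign in the exponent.
  refine ⟨fun x => ς (x, c), fun y => ς (c, y) / ς (c, c),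
    fun x => Real.sqrt |κ| * (m x - m c), ?_⟩
  have habs : ∀ u v : ℝ, Real.sqrt |κ| * u * (Real.sqrt |κ| * v) = |κ| * (u * v) := fun u v => by
    nth_rewrite 3 [← Real.mul_self_sqrt (abs_nonneg κ)]
    ring
  rcases le_total 0 κ with h | h
  · left
    intro p hp
    rw [hexp p hp, habs, abs_of_nonneg h]
  · right
    intro p hp
    rw [hexp p hp, habs, abs_of_nonpos h, neg_mul, neg_neg]

/-- The values that `q(x,y)² / (q(x,x) q(y,y))`, `q` the mixed logarithmic derivative of a regularly
non-separable density, takes near a given point: a nonempty set, and an infinite one if the density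
is a.e. non-Gaussian. -/
theorem IsRegularlyNonSeparable.exists_ratio_set {ς : ℝ × ℝ → ℝ} {U : Set ℝ} (hU : IsOpen U)
    (h : IsRegularlyNonSeparable ς U) {x₀ : ℝ} (hx₀ : x₀ ∈ U) {δ : ℝ} (hδ : 0 < δ) :
    ∃ W : Set ℝ, W.Nonempty ∧ (¬ W.Infinite → ¬ AENotOn IsPseudoGaussianOn ς (U ×ˢ U)) ∧
      ∀ w ∈ W, ∃ x ∈ Metric.ball x₀ δ, ∃ y ∈ Metric.ball x₀ δ,
        mixedLogDeriv ς (x, x) ≠ 0 ∧ mixedLogDeriv ς (y, y) ≠ 0 ∧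
        mixedLogDeriv ς (x, y) ^ 2 / (mixedLogDeriv ς (x, x) * mixedLogDeriv ς (y, y)) = w := by
  obtain ⟨hς, hpos, -, hdiag⟩ := h
  have hG : IsOpen (U ×ˢ U) := hU.prod hU
  have hcont := continuousOn_mixedLogDeriv hG hς hpos
  set q := mixedLogDeriv ς
  have hO : IsOpen (U ∩ Metric.ball x₀ δ) := hU.inter Metric.isOpen_ball
  obtain ⟨c, ⟨hcU, hcδ⟩, hc0⟩ : ∃ c ∈ U ∩ Metric.ball x₀ δ, q (c, c) ≠ 0 := by
    by_contra! hall
    have h0 : volume (U ∩ Metric.ball x₀ δ) = 0 := by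
      refine measure_mono_null (fun x hx => ?_) hdiag
      exact fun hx' => hx' hx.1 (hall x hx)
    exact (hO.measure_pos volume ⟨x₀, hx₀, Metric.mem_ball_self hδ⟩).ne' h0
  have hopen : IsOpen {p ∈ U ×ˢ U | q p ≠ 0} := hcont.isOpen_inter_preimage hG isOpen_ne
  have hmem : {p ∈ U ×ˢ U | q p ≠ 0} ∩ (Metric.ball x₀ δ ×ˢ Metric.ball x₀ δ) ∈ nhds (c, c) :=
    Filter.inter_mem (hopen.mem_nhds ⟨⟨hcU, hcU⟩, hc0⟩)
      ((Metric.isOpen_ball.prod Metric.isOpen_ball).mem_nhds ⟨hcδ, hcδ⟩)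
  obtain ⟨r, hr, hrsub⟩ := Metric.mem_nhds_iff.1 hmem
  rw [← ball_prod_same] at hrsub
  set V := Metric.ball c r with hVdef
  have hV : IsOpen V := Metric.isOpen_ball
  have hVc : IsPreconnected V := (convex_ball c r).isPreconnected
  have hcV : c ∈ V := Metric.mem_ball_self hr
  have hVU : V ×ˢ V ⊆ U ×ˢ U := fun p hp => (hrsub hp).1.1
  have hq0 : ∀ x ∈ V, ∀ y ∈ V, q (x, y) ≠ 0 := fun x hx y hy =>
    (hrsub (show (x, y) ∈ V ×ˢ V from ⟨hx, hy⟩)).1.2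
  have hVδ : ∀ x ∈ V, x ∈ Metric.ball x₀ δ := fun x hx =>
    (hrsub (show (x, x) ∈ V ×ˢ V from ⟨hx, hx⟩)).2.1
  set ρ : ℝ × ℝ → ℝ := fun p => q p ^ 2 / (q (p.1, p.1) * q (p.2, p.2)) with hρ
  have hρc : ContinuousOn ρ (V ×ˢ V) := by
    have hqV : ContinuousOn q (V ×ˢ V) := hcont.mono hVU
    refine (hqV.pow 2).div ((hqV.comp (by fun_prop) fun p hp => ⟨hp.1, hp.1⟩).mul
      (hqV.comp (by fun_prop) fun p hp => ⟨hp.2, hp.2⟩)) ?_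
    exact fun p hp => mul_ne_zero (hq0 _ hp.1 _ hp.1) (hq0 _ hp.2 _ hp.2)
  refine ⟨ρ '' (V ×ˢ V), ⟨ρ (c, c), mem_image_of_mem _ ⟨hcV, hcV⟩⟩, ?_, ?_⟩
  · intro hfin
    -- A connected subset of `ℝ` is infinite unless it has at most one point; here that point is the
    -- value `1` on the diagonal.
    have hsub : (ρ '' (V ×ˢ V)).Subsingleton := by
      by_contra hnt
      rw [Set.not_subsingleton_iff] at hnt
      exact hfin (((hVc.prod hVc).image ρ hρc).infinite_of_nontrivial hnt)
    have hρ1 : ∀ p ∈ V ×ˢ V, ρ p = 1 := by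
      intro p hp
      rw [hsub (mem_image_of_mem _ hp) (mem_image_of_mem ρ (show (c, c) ∈ V ×ˢ V from ⟨hcV, hcV⟩)),
        hρ]
      have := hq0 c hcV c hcV
      simp only
      field_simp
    have hpg : IsPseudoGaussianOn ς (V ×ˢ V) := by
      refine isPseudoGaussianOn_of_sq_eq hV hVc (hς.mono hVU) (fun p hp => hpos p (hVU hp))
        (fun p hp => hq0 _ hp.1 _ hp.2) fun x hx y hy => ?_
      have h1 := hρ1 (x, y) ⟨hx, hy⟩
      rwa [hρ, div_eq_one_iff_eq (mul_ne_zero (hq0 x hx x hx) (hq0 y hy y hy))] at h1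
    rintro ⟨N, hN, hNo, hN0, hnot⟩
    -- The open square minus the nullset `N` is still open and nonempty, and the density is
    -- pseudo-Gaussian there.
    refine hnot (V ×ˢ V ∩ (U ×ˢ U \ N)) inter_subset_right ((hV.prod hV).inter hNo) ?_ ?_
    · by_contra hemp
      rw [not_nonempty_iff_eq_empty] at hemp
      have : V ×ˢ V ⊆ N := fun p hp => by
        by_contra hpN
        exact (hemp ▸ (⟨hp, hVU hp, hpN⟩ : p ∈ V ×ˢ V ∩ (U ×ˢ U \ N)) : p ∈ (∅ : Set _))
      exact ((hV.prod hV).measure_pos volume ⟨(c, c), hcV, hcV⟩).ne' (measure_mono_null this hN0)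
    · obtain ⟨a, b, g, hg⟩ := hpg
      exact ⟨a, b, g, hg.imp (fun H p hp => H p hp.1) (fun H p hp => H p hp.1)⟩
  · rintro w ⟨p, hp, rfl⟩
    exact ⟨p.1, hVδ _ hp.1, p.2, hVδ _ hp.2, hq0 _ hp.1 _ hp.1,
      hq0 _ hp.2 _ hp.2, rfl⟩

/-! ### Diffeomorphisms of intervals -/

theorem strictMonoOn_or_strictAntiOn_of_injOn {h : ℝ → ℝ} {J : Set ℝ} (hJ : J.OrdConnected)
    (hc : ContinuousOn h J) (hi : InjOn h J) : StrictMonoOn h J ∨ StrictAntiOn h J := by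
  rcases J.eq_empty_or_nonempty with rfl | ⟨u, hu⟩
  · exact Or.inl fun x hx => absurd hx (notMem_empty x)
  have : Inhabited J := ⟨⟨u, hu⟩⟩
  rcases (continuousOn_iff_continuous_domRestrict.1 hc).strictMono_of_inj
    (injOn_iff_injective.1 hi) with h' | h'
  · exact Or.inl fun x hx y hy hxy => h' (show (⟨x, hx⟩ : J) < ⟨y, hy⟩ from hxy)
  · exact Or.inr fun x hx y hy hxy => h' (show (⟨x, hx⟩ : J) < ⟨y, hy⟩ from hxy)

/-- A strictly monotone map is an order isomorphism onto its image, and order isomorphisms of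
intervals are homeomorphisms. -/
theorem continuousOn_of_leftInvOn_of_strictMonoOn {h ψ : ℝ → ℝ} {J : Set ℝ} (hJ : J.OrdConnected)
    (hc : ContinuousOn h J) (hm : StrictMonoOn h J) (hψ : LeftInvOn ψ h J) :
    ContinuousOn ψ (h '' J) := by
  have : (h '' J).OrdConnected :=
    ((isPreconnected_iff_ordConnected.2 hJ).image h hc).ordConnected
  rw [continuousOn_iff_continuous_domRestrict]
  have h1 : Continuous fun z => (((hm.orderIso h J).symm z : J) : ℝ) :=
    continuous_subtype_val.comp (hm.orderIso h J).symm.continuous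
  convert h1 using 1
  ext z
  obtain ⟨w, rfl⟩ := (hm.orderIso h J).surjective z
  rw [OrderIso.symm_apply_apply]
  exact hψ w.2

theorem continuousOn_of_leftInvOn {h ψ : ℝ → ℝ} {J : Set ℝ} (hJ : J.OrdConnected)
    (hc : ContinuousOn h J) (hψ : LeftInvOn ψ h J) : ContinuousOn ψ (h '' J) := by
  rcases strictMonoOn_or_strictAntiOn_of_injOn hJ hc hψ.injOn with hm | hm
  · exact continuousOn_of_leftInvOn_of_strictMonoOn hJ hc hm hψ
  · have h1 : ContinuousOn (fun z => ψ (-z)) ((fun x => -h x) '' J) :=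
      continuousOn_of_leftInvOn_of_strictMonoOn hJ hc.neg hm.neg
        fun x hx => by simpa using hψ hx
    have h2 : ContinuousOn (fun z => ψ (- -z)) (h '' J) :=
      h1.comp continuous_neg.continuousOn (by
        rintro _ ⟨x, hx, rfl⟩
        exact ⟨x, hx, rfl⟩)
    simpa only [neg_neg] using h2

theorem isDiffeoOn_of_subsingleton {k : ℕ} (h : ℝ → ℝ) {J : Set ℝ} (hJ : J.Subsingleton) :
    IsDiffeoOn k h J := by
  rcases hJ.eq_empty_or_singleton with rfl | ⟨u, rfl⟩
  · exact ⟨by simp, id, by simp, fun x hx => absurd hx (notMem_empty x)⟩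
  · refine ⟨(contDiffOn_const (c := h u)).congr (by rintro x rfl; rfl), fun _ => u,
      contDiffOn_const, by rintro x rfl; rfl⟩

/-- Lets local questions at any point of `J`, endpoints included, be settled on a compact interval
with endpoints in `J`. -/
theorem exists_Icc_mem_nhdsWithin {J : Set ℝ} (hnt : J.Nontrivial)
    {u : ℝ} (hu : u ∈ J) : ∃ c ∈ J, ∃ e ∈ J, c < e ∧ u ∈ Icc c e ∧ Icc c e ∈ nhdsWithin u J := by
  by_cases h1 : ∃ c ∈ J, c < u <;> by_cases h2 : ∃ e ∈ J, u < e
  · obtain ⟨c, hc, hcu⟩ := h1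
    obtain ⟨e, he, hue⟩ := h2
    exact ⟨c, hc, e, he, hcu.trans hue, ⟨hcu.le, hue.le⟩,
      mem_nhdsWithin_of_mem_nhds (Icc_mem_nhds hcu hue)⟩
  · obtain ⟨c, hc, hcu⟩ := h1
    push Not at h2
    refine ⟨c, hc, u, hu, hcu, ⟨hcu.le, le_rfl⟩, ?_⟩
    filter_upwards [mem_nhdsWithin_of_mem_nhds (Ici_mem_nhds hcu), self_mem_nhdsWithin]
      with x hx hxJ using ⟨hx, h2 x hxJ⟩
  · obtain ⟨e, he, hue⟩ := h2
    push Not at h1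
    refine ⟨u, hu, e, he, hue, ⟨le_rfl, hue.le⟩, ?_⟩
    filter_upwards [mem_nhdsWithin_of_mem_nhds (Iic_mem_nhds hue), self_mem_nhdsWithin]
      with x hx hxJ using ⟨h1 x hxJ, hx⟩
  · push Not at h1 h2
    obtain ⟨x, hx, hxu⟩ := hnt.exists_ne u
    exact absurd (le_antisymm (h2 x hx) (h1 x hx)) hxu

/-- A function on an interval that extends, from each compact subinterval, to a `C^1`-function on
an open set, with nonvanishing derivative, is a `C^1`-diffeomorphism onto its image. -/
theorem isDiffeoOn_of_exists_extension {h : ℝ → ℝ} {J : Set ℝ} (hJ : J.OrdConnected)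
    (hext : ∀ c ∈ J, ∀ e ∈ J, c < e → ∃ (φ : ℝ → ℝ) (O : Set ℝ), IsOpen O ∧ Icc c e ⊆ O ∧
      ContDiffOn ℝ 1 φ O ∧ ∀ w ∈ Icc c e, h w = φ w ∧ deriv φ w ≠ 0) : IsDiffeoOn 1 h J := by
  rcases J.subsingleton_or_nontrivial with hs | hnt
  · exact isDiffeoOn_of_subsingleton h hs
  have hcd : ContDiffOn ℝ 1 h J := by
    intro u hu
    obtain ⟨c, hc, e, he, hce, huI, hI⟩ := exists_Icc_mem_nhdsWithin hnt hu
    obtain ⟨φ, O, hO, hcO, hφ, hw⟩ := hext c hc e he hce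
    refine ((hφ.contDiffAt (hO.mem_nhds (hcO huI))).contDiffWithinAt).congr_of_eventuallyEq
      ?_ (hw u huI).1
    filter_upwards [hI] with w hwI using (hw w hwI).1
  have hinj : InjOn h J := by
    have key : ∀ c ∈ J, ∀ e ∈ J, c < e → h c ≠ h e := by
      intro c hc e he hce heq
      obtain ⟨φ, O, hO, hcO, hφ, hw⟩ := hext c hc e he hce
      rw [(hw c ⟨le_rfl, hce.le⟩).1, (hw e ⟨hce.le, le_rfl⟩).1] at heq
      -- Rolle's theorem: equal values would force a zero of the derivative.
      obtain ⟨z, hz, hz0⟩ := exists_deriv_eq_zero hce (hφ.continuousOn.mono hcO) heq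
      exact (hw z (Ioo_subset_Icc_self hz)).2 hz0
    intro c hc e he heq
    by_contra hne
    rcases lt_or_gt_of_ne hne with hlt | hlt
    · exact key c hc e he hlt heq
    · exact key e he c hc hlt heq.symm
  set ψ := Function.invFunOn h J
  have hψ : LeftInvOn ψ h J := hinj.leftInvOn_invFunOn
  refine ⟨by exact_mod_cast hcd, ψ, ?_, hψ⟩
  rintro _ ⟨u, hu, rfl⟩
  obtain ⟨c, hc, e, he, hce, huI, hI⟩ := exists_Icc_mem_nhdsWithin hnt hu
  obtain ⟨φ, O, hO, hcO, hφ, hw⟩ := hext c hc e he hce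
  have hφu : ContDiffAt ℝ 1 φ u := hφ.contDiffAt (hO.mem_nhds (hcO huI))
  have hstrict := (hφu.hasStrictDerivAt one_ne_zero).hasStrictFDerivAt_equiv (hw u huI).2
  obtain ⟨θ, hθ, hθl⟩ : ∃ θ : ℝ → ℝ, ContDiffAt ℝ 1 θ (φ u) ∧ ∀ᶠ x in nhds u, θ (φ x) = x :=
    ⟨_, hφu.to_localInverse hstrict.hasFDerivAt one_ne_zero, hstrict.eventually_left_inverse⟩
  rw [← (hw u huI).1] at hθ
  have hψu : ψ (h u) = u := hψ hu
  have hleft : ∀ᶠ x in nhdsWithin u J, h x = φ x ∧ θ (φ x) = x := by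
    filter_upwards [hI, mem_nhdsWithin_of_mem_nhds hθl] with x hx hx' using ⟨(hw x hx).1, hx'⟩
  -- Continuity of `ψ` keeps its values near `u`, where the inverse function theorem for the
  -- extension `φ` identifies it with the smooth local inverse `θ`.
  have htend : Filter.Tendsto ψ (nhdsWithin (h u) (h '' J)) (nhdsWithin u J) := by
    refine tendsto_nhdsWithin_iff.2 ⟨?_, ?_⟩
    · have := continuousOn_of_leftInvOn hJ hcd.continuousOn hψ (h u) (mem_image_of_mem h hu)
      rwa [ContinuousWithinAt, hψu] at this
    · filter_upwards [self_mem_nhdsWithin]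
      rintro _ ⟨x, hx, rfl⟩
      rwa [hψ hx]
  have hcong : ∀ᶠ z in nhdsWithin (h u) (h '' J),
      ψ z = θ z := by
    filter_upwards [htend.eventually hleft, self_mem_nhdsWithin]
    rintro _ ⟨h1, h2⟩ ⟨x, hx, rfl⟩
    rw [hψ hx] at h1 h2 ⊢
    rw [h1, h2]
  exact_mod_cast (hθ.contDiffWithinAt (s := h '' J)).congr_of_eventuallyEq hcong
    (hcong.self_of_nhdsWithin (mem_image_of_mem h hu))

/-! ### Invertible maps and their Jacobian matrices -/

/-- The Jacobian matrix. -/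
noncomputable def jacobian {d : ℕ} (g : (Fin d → ℝ) → Fin d → ℝ) (x : Fin d → ℝ) :
    Matrix (Fin d) (Fin d) ℝ :=
  LinearMap.toMatrix' (fderiv ℝ g x : (Fin d → ℝ) →ₗ[ℝ] Fin d → ℝ)

section
variable {d k : ℕ} {g : (Fin d → ℝ) → Fin d → ℝ} {G : Set (Fin d → ℝ)}

theorem jacobian_apply (g : (Fin d → ℝ) → Fin d → ℝ) (x : Fin d → ℝ) (i j : Fin d) :
    jacobian g x i j = fderiv ℝ g x (Pi.single j 1) i := by
  simp [jacobian, LinearMap.toMatrix'_apply]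

theorem fderiv_apply_eq_sum (g : (Fin d → ℝ) → Fin d → ℝ) (x v : Fin d → ℝ) (i : Fin d) :
    fderiv ℝ g x v i = ∑ j, jacobian g x i j * v j := by
  have : (jacobian g x).mulVec v = fderiv ℝ g x v :=
    LinearMap.toMatrix'_mulVec (fderiv ℝ g x : (Fin d → ℝ) →ₗ[ℝ] Fin d → ℝ) v
  rw [← this]
  rfl

theorem IsInvertibleOn.of_le {l : ℕ} (h : IsInvertibleOn k g G) (hl : l ≤ k) :
    IsInvertibleOn l g G := by
  obtain ⟨h1, h2, h3, ψ, h4, h5⟩ := h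
  have hle : (l : WithTop ℕ∞) ≤ k := by exact_mod_cast hl
  exact ⟨h1, h2, h3.of_le hle, ψ, h4.of_le hle, h5⟩

theorem IsInvertibleOn.isOpen_image (h : IsInvertibleOn k g G) {O : Set (Fin d → ℝ)}
    (hO : IsOpen O) (hOG : O ⊆ G) : IsOpen (g '' O) := by
  obtain ⟨-, h2, -, ψ, h4, h5⟩ := h
  have : g '' O = g '' G ∩ ψ ⁻¹' O := by
    ext z
    constructor
    · rintro ⟨x, hx, rfl⟩
      exact ⟨mem_image_of_mem g (hOG hx), by rwa [mem_preimage, h5 (hOG hx)]⟩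
    · rintro ⟨⟨x, hx, rfl⟩, hz⟩
      rw [mem_preimage, h5 hx] at hz
      exact mem_image_of_mem g hz
  rw [this]
  exact h4.continuousOn.isOpen_inter_preimage h2 hO

theorem IsInvertibleOn.comp {f h : (Fin d → ℝ) → Fin d → ℝ} {F H : Set (Fin d → ℝ)}
    (hf : IsInvertibleOn k f F) (hh : IsInvertibleOn k h H) :
    IsInvertibleOn k (h ∘ f) (F ∩ f ⁻¹' H) := by
  have hsub : f '' (F ∩ f ⁻¹' H) ⊆ H := by
    rintro _ ⟨x, hx, rfl⟩
    exact hx.2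
  have hO : IsOpen (F ∩ f ⁻¹' H) := hf.2.2.1.continuousOn.isOpen_inter_preimage hf.1 hh.1
  have hO' : IsOpen (h '' (f '' (F ∩ f ⁻¹' H))) :=
    hh.isOpen_image (hf.isOpen_image hO inter_subset_left) hsub
  rw [← image_comp] at hO'
  obtain ⟨-, -, f1, ψ, f2, f3⟩ := hf
  obtain ⟨-, -, h1, χ, h2, h3⟩ := hh
  refine ⟨hO, hO', h1.comp (f1.mono inter_subset_left) (fun x hx => hx.2), ψ ∘ χ, ?_, ?_⟩
  · refine f2.comp (h2.mono ?_) ?_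
    · rintro _ ⟨x, hx, rfl⟩
      exact mem_image_of_mem h hx.2
    · rintro _ ⟨x, hx, rfl⟩
      rw [Function.comp_apply, h3 hx.2]
      exact mem_image_of_mem f hx.1
  · intro x hx
    simp only [Function.comp_apply]
    rw [h3 hx.2, f3 hx.1]

theorem jacobian_mul_jacobian_of_leftInvOn {ψ : (Fin d → ℝ) → Fin d → ℝ} (hG : IsOpen G)
    (hgG : IsOpen (g '' G)) (hg : ContDiffOn ℝ 1 g G) (hψ : ContDiffOn ℝ 1 ψ (g '' G))
    (hl : LeftInvOn ψ g G) {x : Fin d → ℝ} (hx : x ∈ G) :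
    jacobian g x * jacobian ψ (g x) = 1 := by
  have d1 := ((hg.contDiffAt (hG.mem_nhds hx)).differentiableAt one_ne_zero).hasFDerivAt
  have d2 := ((hψ.contDiffAt (hgG.mem_nhds (mem_image_of_mem g hx))).differentiableAt
    one_ne_zero).hasFDerivAt
  have d3 := d2.comp x d1
  have d4 : HasFDerivAt (ψ ∘ g) (ContinuousLinearMap.id ℝ (Fin d → ℝ)) x := by
    refine (hasFDerivAt_id x).congr_of_eventuallyEq ?_
    filter_upwards [hG.mem_nhds hx] with y hy using hl hy
  have e := d3.unique d4
  refine mul_eq_one_comm.1 ?_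
  rw [jacobian, jacobian, ← LinearMap.toMatrix'_comp, ← ContinuousLinearMap.toLinearMap_comp, e]
  exact LinearMap.toMatrix'_id

theorem continuousOn_jacobian (hG : IsOpen G) (hg : ContDiffOn ℝ 1 g G) (i j : Fin d) :
    ContinuousOn (fun x => jacobian g x i j) G := by
  simp only [jacobian_apply]
  have h1 : ContinuousOn (fderiv ℝ g) G := hg.continuousOn_fderiv_of_isOpen hG le_rfl
  exact (continuous_apply i).comp_continuousOn (h1.clm_apply continuousOn_const)

/-- An invertible map is monomial on a convex set if each row of its Jacobian matrix has at most one
nonzero entry there. -/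
theorem IsInvertibleOn.isMonomialOn_of_convex (h : IsInvertibleOn 1 g G) {C : Set (Fin d → ℝ)}
    (hC : Convex ℝ C) (hCG : C ⊆ G)
    (hrow : ∀ x ∈ C, ∀ i j l, j ≠ l → jacobian g x i j * jacobian g x i l = 0) :
    IsMonomialOn g C := by
  intro x₀ hx₀
  rw [hC.isPreconnected.connectedComponentIn hx₀]
  obtain ⟨hG, hgG, hg, ψ, hψ, hl⟩ := h
  have hg : ContDiffOn ℝ 1 g G := by exact_mod_cast hg
  have hψ : ContDiffOn ℝ 1 ψ (g '' G) := by exact_mod_cast hψ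
  have hAB : ∀ x ∈ C, jacobian g x * jacobian ψ (g x) = 1 := fun x hx =>
    jacobian_mul_jacobian_of_leftInvOn hG hgG hg hψ hl (hCG hx)
  have hAcont : ∀ i j, ContinuousOn (fun x => jacobian g x i j) C := fun i j =>
    (continuousOn_jacobian hG hg i j).mono hCG
  have hex : ∀ x ∈ C, ∀ i, ∃ j, jacobian g x i j ≠ 0 := by
    intro x hx i
    by_contra! h0
    have := congrFun (congrFun (hAB x hx) i) i
    rw [Matrix.mul_apply, Matrix.one_apply_eq] at this
    simp [h0] at this
  choose s hs using hex x₀ hx₀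
  have hs0 : ∀ x ∈ C, ∀ i, jacobian g x i (s i) ≠ 0 := by
    intro x hx i h0
    -- `N` cannot vanish on `C`, because exactly one entry of the row is nonzero. A change in the
    -- position of that entry would force a zero by the intermediate value theorem.
    set N : (Fin d → ℝ) → ℝ := fun x => jacobian g x i (s i) ^ 2 -
      ∑ l ∈ Finset.univ.erase (s i), jacobian g x i l ^ 2 with hN
    have hNc : ContinuousOn N C :=
      ((hAcont i (s i)).pow 2).sub (continuousOn_finsetSum _ fun l _ => (hAcont i l).pow 2)
    have hle : N x ≤ 0 := by
      simp only [hN, h0]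
      have : 0 ≤ ∑ l ∈ Finset.univ.erase (s i), jacobian g x i l ^ 2 :=
        Finset.sum_nonneg fun l _ => sq_nonneg _
      linarith
    have hge : 0 ≤ N x₀ := by
      have : ∑ l ∈ Finset.univ.erase (s i), jacobian g x₀ i l ^ 2 = 0 :=
        Finset.sum_eq_zero fun l hl' => by
          have := hrow x₀ hx₀ i (s i) l (Finset.ne_of_mem_erase hl').symm
          rw [(mul_eq_zero.1 this).resolve_left (hs i)]
          norm_num
      simp only [hN, this, sub_zero]
      exact sq_nonneg _
    obtain ⟨z, hz, hz0⟩ := hC.isPreconnected.intermediate_value hx hx₀ hNc ⟨hle, hge⟩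
    simp only [hN] at hz0
    obtain ⟨j, hj⟩ := hex z hz i
    have hzero : ∀ l, l ≠ j → jacobian g z i l = 0 := fun l hlj =>
      (mul_eq_zero.1 (hrow z hz i j l hlj.symm)).resolve_left hj
    by_cases hjs : j = s i
    · rw [Finset.sum_eq_zero (fun l hl' => by
        rw [hzero l (hjs ▸ Finset.ne_of_mem_erase hl')]; norm_num), ← hjs, sub_zero] at hz0
      exact hj (pow_eq_zero_iff two_ne_zero |>.1 hz0)
    · rw [hzero _ (Ne.symm hjs), Finset.sum_eq_single_of_mem j
        (Finset.mem_erase.2 ⟨hjs, Finset.mem_univ _⟩)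
        (fun l _ hlj => by rw [hzero l hlj]; norm_num)] at hz0
      exact hj (pow_eq_zero_iff two_ne_zero |>.1 (by linarith))
  have hA0 : ∀ x ∈ C, ∀ i l, l ≠ s i → jacobian g x i l = 0 := fun x hx i l hls =>
    (mul_eq_zero.1 (hrow x hx i (s i) l hls.symm)).resolve_left (hs0 x hx i)
  have hinj : Function.Injective s := by
    intro i i' hii
    by_contra hne
    have hAB' : ∀ i i', jacobian g x₀ i (s i) * jacobian ψ (g x₀) (s i) i' =
        (1 : Matrix (Fin d) (Fin d) ℝ) i i' := fun i i' => by
      rw [← hAB x₀ hx₀, Matrix.mul_apply, Finset.sum_eq_single (s i)]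
      · intro l _ hls
        rw [hA0 x₀ hx₀ i l hls, zero_mul]
      · simp
    have e1 := hAB' i i'
    have e2 := hAB' i' i'
    rw [Matrix.one_apply_ne hne] at e1
    rw [Matrix.one_apply_eq, ← hii, (mul_eq_zero.1 e1).resolve_left (hs i), mul_zero] at e2
    exact zero_ne_one e2
  set σ : Equiv.Perm (Fin d) := Equiv.ofBijective s (Finite.injective_iff_bijective.1 hinj)
  have hσ : ∀ i, σ i = s i := fun i => rfl
  have hline : ∀ x ∈ G, ∀ (v : Fin d → ℝ) (i : Fin d) (t : ℝ) (y : Fin d → ℝ),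
      y + t • v = x → HasDerivAt (fun t : ℝ => g (y + t • v) i)
        (∑ j, jacobian g x i j * v j) t := by
    rintro x hx v i t y rfl
    have d1 := ((hg.contDiffAt (hG.mem_nhds hx)).differentiableAt one_ne_zero).hasFDerivAt
    have d2 : HasDerivAt (fun t : ℝ => y + t • v) v t := by
      simpa using ((hasDerivAt_id t).smul_const v).const_add y
    have d3 := d1.comp_hasDerivAt t d2
    have d4 := (hasDerivAt_pi.1 d3) i
    rwa [fderiv_apply_eq_sum] at d4
  have hseg : ∀ x ∈ C, ∀ y ∈ C, ∀ t ∈ Icc (0 : ℝ) 1, x + t • (y - x) ∈ C :=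
    fun x hx y hy t ht => hC.add_smul_sub_mem hx hy ht
  -- Along the segment from `x` to `y` the only nonzero partial derivative of `g_i` is multiplied by
  -- `(y - x)_{s i} = 0`.
  have hdep : ∀ i, ∀ x ∈ C, ∀ y ∈ C, x (s i) = y (s i) → g x i = g y i := by
    intro i x hx y hy hxy
    have hd : ∀ t ∈ Icc (0 : ℝ) 1, HasDerivAt (fun t : ℝ => g (x + t • (y - x)) i) 0 t := by
      intro t ht
      have hm := hseg x hx y hy t ht
      convert hline _ (hCG hm) (y - x) i t x rfl using 1
      refine (Finset.sum_eq_zero fun l _ => ?_).symm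
      by_cases hls : l = s i
      · rw [hls, Pi.sub_apply, hxy, sub_self, mul_zero]
      · rw [hA0 _ hm i l hls, zero_mul]
    have hconst := constant_of_has_deriv_right_zero
      (fun t ht => (hd t ht).continuousAt.continuousWithinAt)
      (fun t ht => (hd t (Ico_subset_Icc_self ht)).hasDerivWithinAt) 1 ⟨zero_le_one, le_rfl⟩
    simpa using hconst.symm
  -- The factor is read off at an arbitrary point of `C` with the prescribed coordinate; `hdep`
  -- makes the choice irrelevant.
  set F : Fin d → ℝ → ℝ := fun j w =>
    g (Function.invFunOn (fun y : Fin d → ℝ => y j) C w) (σ.symm j) with hF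
  have hFg : ∀ y ∈ C, ∀ j, F j (y j) = g y (σ.symm j) := by
    intro y hy j
    have hmem : ∃ z ∈ C, z j = y j := ⟨y, hy, rfl⟩
    have hj : s (σ.symm j) = j := σ.apply_symm_apply j
    refine hdep (σ.symm j) _ (Function.invFunOn_mem hmem) y hy ?_
    rw [hj]
    exact Function.invFunOn_eq hmem
  refine ⟨σ, F, fun j => ?_, fun y hy i => ?_⟩
  · refine isDiffeoOn_of_exists_extension
      (hC.isPreconnected.image _ (continuous_apply j).continuousOn).ordConnected ?_
    rintro _ ⟨x, hx, rfl⟩ _ ⟨y, hy, rfl⟩ hlt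
    simp only at hlt ⊢
    have hpos : 0 < y j - x j := sub_pos.2 hlt
    -- The segment from `x` to `y`, parametrised by its `j`-th coordinate. It leaves `C` but stays
    -- in `G` slightly beyond its ends, which gives the required extension.
    set p : ℝ → Fin d → ℝ := fun w => x + ((w - x j) / (y j - x j)) • (y - x) with hp
    have hpcd : ContDiff ℝ 1 p := by
      simp only [hp]
      fun_prop
    have hpC : ∀ w ∈ Icc (x j) (y j), p w ∈ C := fun w hw =>
      hseg x hx y hy _ ⟨div_nonneg (sub_nonneg.2 hw.1) hpos.le,
        (div_le_one hpos).2 (by linarith [hw.2])⟩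
    have hpj : ∀ w, p w j = w := fun w => by
      simp only [hp, Pi.add_apply, Pi.smul_apply, Pi.sub_apply, smul_eq_mul]
      field_simp
      ring
    have hj : s (σ.symm j) = j := σ.apply_symm_apply j
    refine ⟨fun w => g (p w) (σ.symm j), p ⁻¹' G, hG.preimage hpcd.continuous,
      fun w hw => hCG (hpC w hw), ?_, fun w hw => ⟨?_, ?_⟩⟩
    · exact (contDiff_apply ℝ ℝ (σ.symm j)).comp_contDiffOn
        (hg.comp hpcd.contDiffOn fun w hw => hw)
    · have := hFg (p w) (hpC w hw) j
      rwa [hpj] at this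
    · have hd := hline (p w) (hCG (hpC w hw)) (y - x) (σ.symm j) ((w - x j) / (y j - x j)) x rfl
      have haff : HasDerivAt (fun w => (w - x j) / (y j - x j)) (1 / (y j - x j)) w :=
        ((hasDerivAt_id w).sub_const (x j)).div_const _
      have hd' := hd.comp w haff
      have hd'' : HasDerivAt (fun w => g (p w) (σ.symm j)) _ w := hd'
      rw [hd''.deriv, Finset.sum_eq_single j]
      · have := hs0 (p w) (hpC w hw) (σ.symm j)
        rw [hj] at this
        exact mul_ne_zero (mul_ne_zero this hpos.ne') (one_div_ne_zero hpos.ne')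
      · intro l _ hlj
        rw [hA0 (p w) (hpC w hw) (σ.symm j) l (by rwa [hj]), zero_mul]
      · simp
  · rw [hFg y hy, Equiv.symm_apply_apply]

end

/-! ### Spatial supports -/

section
variable {Ω : Type*} [MeasurableSpace Ω] {μ : Measure Ω} {d : ℕ}

theorem isClosed_spatialSupport {T : Type*} (Y : T → Ω → Fin d → ℝ) :
    IsClosed (spatialSupport μ Y) := isClosed_closure

theorem ae_mem_spatialSupport {T : Type*} {Y : T → Ω → Fin d → ℝ} {t : T}
    (h : Measurable (Y t)) : ∀ᵐ ω ∂μ, Y t ω ∈ spatialSupport μ Y := by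
  have : ∀ᵐ y ∂(μ.map (Y t)), y ∈ (μ.map (Y t)).support := Measure.support_mem_ae
  filter_upwards [ae_of_ae_map h.aemeasurable this] with ω hω
  exact subset_closure (mem_iUnion.2 ⟨t, hω⟩)

/-- One null event must serve uncountably many times: a countable dense set of times suffices, as
paths are continuous and the support is closed. -/
theorem IsContinuousProcess.ae_forall_mem_spatialSupport {a b : ℝ} {Y : Icc a b → Ω → Fin d → ℝ}
    (h : IsContinuousProcess Y) : ∀ᵐ ω ∂μ, ∀ t, Y t ω ∈ spatialSupport μ Y := by
  obtain ⟨s, hs, hsd⟩ := TopologicalSpace.exists_countable_dense (Icc a b)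
  have : ∀ᵐ ω ∂μ, ∀ t ∈ s, Y t ω ∈ spatialSupport μ Y :=
    (ae_ball_iff hs).2 fun t _ => ae_mem_spatialSupport (h.measurable t)
  filter_upwards [this] with ω hω t
  exact (isClosed_spatialSupport Y).closure_subset
    (((h.continuous_path ω).range_subset_closure_image_dense hsd).trans
      (closure_mono (t := spatialSupport μ Y) (by
        rintro _ ⟨t, ht, rfl⟩
        exact hω t ht)) (mem_range_self t))

/-- Needed for `h ∘ f` to be invertible on an open superset of `D_S`, as `h` is controlled only near
`D_X`. -/
theorem mapsTo_spatialSupport {T : Type*} {S X : T → Ω → Fin d → ℝ}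
    {f : (Fin d → ℝ) → Fin d → ℝ} {G : Set (Fin d → ℝ)} (hG : IsOpen G)
    (hf : ContinuousOn f G) (hSG : spatialSupport μ S ⊆ G)
    (hS : ∀ t, Measurable (S t)) (hX : ∀ t, Measurable (X t))
    (hXS : ∀ᵐ ω ∂μ, ∀ t, X t ω = f (S t ω)) :
    MapsTo f (spatialSupport μ S) (spatialSupport μ X) := by
  have h1 : MapsTo f (⋃ t, (μ.map (S t)).support) (⋃ t, (μ.map (X t)).support) := by
    intro x hx
    obtain ⟨t, ht⟩ := mem_iUnion.1 hx
    have hxG : x ∈ G := hSG (subset_closure hx)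
    refine mem_iUnion.2 ⟨t, ?_⟩
    rw [Measure.mem_support_iff_forall] at ht ⊢
    intro U hU
    obtain ⟨V, hVU, hVo, hV⟩ := mem_nhds_iff.1 hU
    have hW : IsOpen (G ∩ f ⁻¹' V) := hf.isOpen_inter_preimage hG hVo
    refine lt_of_lt_of_le (ht _ (hW.mem_nhds ⟨hxG, hV⟩)) ?_
    rw [Measure.map_apply (hS t) hW.measurableSet]
    refine le_trans ?_ (measure_mono hVU)
    rw [Measure.map_apply (hX t) hVo.measurableSet]
    refine measure_mono_ae ?_
    filter_upwards [hXS] with ω hω hω'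
    change X t ω ∈ V
    rw [hω t]
    exact hω'.2
  exact h1.closure_of_continuousOn (hf.mono hSG)

end

/-! ### Product densities -/

theorem pi_withDensity_ofReal {ι : Type*} [Fintype ι] {α : ι → Type*} [∀ i, MeasurableSpace (α i)]
    (ν : ∀ i, Measure (α i)) [∀ i, SigmaFinite (ν i)] {f : ∀ i, α i → ℝ}
    (hf : ∀ i, Integrable (f i) (ν i)) (h0 : ∀ i x, 0 ≤ f i x) :
    Measure.pi (fun i => (ν i).withDensity fun x => ENNReal.ofReal (f i x)) =
      (Measure.pi ν).withDensity fun x => ENNReal.ofReal (∏ i, f i (x i)) := by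
  have : ∀ i, IsFiniteMeasure ((ν i).withDensity fun x => ENNReal.ofReal (f i x)) := fun i =>
    isFiniteMeasure_withDensity_ofReal (hf i).2
  refine Measure.pi_eq fun s hs => ?_
  have hr : ∀ i, Integrable (f i) ((ν i).restrict (s i)) := fun i => (hf i).restrict
  rw [withDensity_apply _ (MeasurableSet.univ_pi hs), Measure.restrict_pi_pi,
    ← ofReal_integral_eq_lintegral_ofReal (Integrable.fintype_prod_dep hr)
      (Filter.Eventually.of_forall fun x => Finset.prod_nonneg fun i _ => h0 i _),
    integral_fintype_prod_eq_prod, ENNReal.ofReal_prod_of_nonneg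
      fun i _ => integral_nonneg (h0 i)]
  refine Finset.prod_congr rfl fun i _ => ?_
  rw [withDensity_apply _ (hs i), ofReal_integral_eq_lintegral_ofReal (hr i)
    (Filter.Eventually.of_forall (h0 i))]

section
variable {Ω : Type*} [MeasurableSpace Ω] {μ : Measure Ω} [IsProbabilityMeasure μ] {d : ℕ}

theorem IsDensityOf.integrable {Z : Ω → ℝ × ℝ} {ς : ℝ × ℝ → ℝ} (h : IsDensityOf μ Z ς) :
    Integrable ς := by
  obtain ⟨h1, h2, h3⟩ := h
  refine ⟨h1.aestronglyMeasurable, ?_⟩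
  rw [hasFiniteIntegral_iff_ofReal (Filter.Eventually.of_forall h2),
    ← setLIntegral_univ, ← withDensity_apply _ MeasurableSet.univ, ← h3]
  exact measure_lt_top _ _

/-- The joint density, at `(x, y)`, of two random vectors of which the pairs of coordinates are
independent with densities `ζ i`. -/
def pairDensity (ζ : Fin d → ℝ × ℝ → ℝ) (z : (Fin d → ℝ) × (Fin d → ℝ)) : ℝ :=
  ∏ i, ζ i (z.1 i, z.2 i)

theorem measurable_pairDensity {ζ : Fin d → ℝ × ℝ → ℝ} (h : ∀ i, Measurable (ζ i)) :
    Measurable (pairDensity ζ) :=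
  Finset.measurable_prod _ fun i _ => (h i).comp (by fun_prop)

theorem measureReal_eq_integral_pairDensity {T : Type*} {S : T → Ω → Fin d → ℝ} (hS : IsIC μ S)
    {s t : T} (hs : Measurable (S s)) (ht : Measurable (S t)) {ζ : Fin d → ℝ × ℝ → ℝ}
    (hζ : ∀ i, IsDensityOf μ (fun ω => (S s ω i, S t ω i)) (ζ i)) {E F : Set (Fin d → ℝ)}
    (hE : MeasurableSet E) (hF : MeasurableSet F) :
    μ.real {ω | S s ω ∈ E ∧ S t ω ∈ F} = ∫ z in E ×ˢ F, pairDensity ζ z := by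
  have hind : iIndepFun (fun (i : Fin d) (ω : Ω) => (S s ω i, S t ω i)) μ :=
    hS.comp (fun _ x => (x s, x t)) fun i => by fun_prop
  have hm : ∀ i, Measurable fun ω => (S s ω i, S t ω i) := fun i => by fun_prop
  have hlaw := (iIndepFun_iff_map_fun_eq_pi_map fun i => (hm i).aemeasurable).1 hind
  simp only [(hζ _).2.2] at hlaw
  rw [pi_withDensity_ofReal (fun _ : Fin d => (volume : Measure (ℝ × ℝ)))
    (fun i => (hζ i).integrable) fun i => (hζ i).2.1] at hlaw
  -- Independence concerns the `d` pairs of coordinates, the claim a pair of `d`-vectors; the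
  -- reshuffling preserves volume.
  set e := MeasurableEquiv.arrowProdEquivProdArrow ℝ ℝ (Fin d) with he
  have hmp : MeasurePreserving e volume volume :=
    volume_measurePreserving_arrowProdEquivProdArrow ℝ ℝ (Fin d)
  have hEF : MeasurableSet (E ×ˢ F) := hE.prod hF
  have hset : {ω | S s ω ∈ E ∧ S t ω ∈ F} =
      (fun ω i => (S s ω i, S t ω i)) ⁻¹' (e ⁻¹' (E ×ˢ F)) := rfl
  have hlint : μ {ω | S s ω ∈ E ∧ S t ω ∈ F} =
      ∫⁻ z in E ×ˢ F, ENNReal.ofReal (pairDensity ζ z) := by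
    rw [hset, ← Measure.map_apply (measurable_pi_lambda _ hm) (e.measurable hEF), hlaw,
      withDensity_apply _ (e.measurable hEF), ← hmp.setLIntegral_comp_preimage hEF
      (measurable_pairDensity fun i => (hζ i).1).ennreal_ofReal]
    rfl
  have h0 : ∀ z, 0 ≤ pairDensity ζ z := fun z => Finset.prod_nonneg fun i _ => (hζ i).2.1 _
  rw [integral_eq_lintegral_of_nonneg_ae (Filter.Eventually.of_forall h0)
    (measurable_pairDensity fun i => (hζ i).1).aestronglyMeasurable, ← hlint]
  rfl

end

/-! ### The cross-ratio identity -/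

section
variable {d : ℕ} {g : (Fin d → ℝ) → Fin d → ℝ} {G D : Set (Fin d → ℝ)}

/-- By injectivity and openness of `g` on `D`, preimages of small balls shrink to a point. -/
theorem tendsto_inter_preimage_ball (hD : ∀ O ⊆ D, IsOpen O → IsOpen (g '' O)) (hDo : IsOpen D)
    (hi : InjOn g D) {x : Fin d → ℝ} (hx : x ∈ D) :
    Filter.Tendsto (fun ε => D ∩ g ⁻¹' Metric.ball (g x) ε) (nhdsWithin 0 (Ioi 0))
      (nhds x).smallSets := by
  rw [Filter.tendsto_smallSets_iff]
  intro U hU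
  obtain ⟨V, hVU, hVo, hxV⟩ := mem_nhds_iff.1 hU
  have hO : IsOpen (g '' (D ∩ V)) := hD _ inter_subset_left (hDo.inter hVo)
  obtain ⟨r, hr, hsub⟩ := Metric.isOpen_iff.1 hO (g x) (mem_image_of_mem g ⟨hx, hxV⟩)
  filter_upwards [Ioo_mem_nhdsGT hr] with ε hε
  rintro z ⟨hzD, hz⟩
  obtain ⟨w, hw, hwz⟩ := hsub (Metric.ball_subset_ball hε.2.le hz)
  exact hVU (hi hw.1 hzD hwz ▸ hw.2)

theorem measureReal_pos_of_isOpen {O : Set (Fin d → ℝ)} (hO : IsOpen O) (hne : O.Nonempty)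
    (hfin : volume O ≠ ⊤) : 0 < volume.real O :=
  ENNReal.toReal_pos (hO.measure_pos volume hne).ne' hfin

variable {Ω : Type*} [MeasurableSpace Ω] {μ : Measure Ω}

/-- Balls of the sup norm are boxes, so the event is an intersection of one event for each
coordinate process. -/
theorem IsIC.measureReal_ball {T : Type*} {Y : T → Ω → Fin d → ℝ} (hY : IsIC μ Y) (s t : T)
    (u v : Fin d → ℝ) {ε : ℝ} (hε : 0 < ε) :
    μ.real {ω | Y s ω ∈ Metric.ball u ε ∧ Y t ω ∈ Metric.ball v ε} =
      ∏ i, μ.real {ω | Y s ω i ∈ Metric.ball (u i) ε ∧ Y t ω i ∈ Metric.ball (v i) ε} := by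
  have h := iIndepFun_iff_measure_inter_preimage_eq_mul.1 hY Finset.univ
    (sets := fun i => {x : T → ℝ | x s ∈ Metric.ball (u i) ε ∧ x t ∈ Metric.ball (v i) ε})
    fun i _ => ((measurable_pi_apply s) Metric.isOpen_ball.measurableSet).inter
      ((measurable_pi_apply t) Metric.isOpen_ball.measurableSet)
  simp only [Measure.real]
  rw [← ENNReal.toReal_prod]
  congr 1
  convert h using 2
  · ext ω
    simp only [ball_pi _ hε, mem_ofPred_eq, mem_pi, mem_univ, true_imp_iff, Finset.mem_univ,
      iInter_true, mem_iInter, mem_preimage]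
    exact forall_and.symm
  · rfl

/-- If an invertible map `g` transforms a process `S`, with independent coordinates that have
densities, into a process with independent coordinates, then the joint density of `(S s, S t)`
satisfies a multiplicative cross-ratio identity. -/
theorem pairDensity_mul_pairDensity [IsProbabilityMeasure μ] {T : Type*}
    {S Y : T → Ω → Fin d → ℝ} {s t : T}
    (hg : IsInvertibleOn 1 g G) (hDo : IsOpen D) (hDG : D ⊆ G)
    (hS : IsIC μ S) (hs : Measurable (S s)) (ht : Measurable (S t))
    (hsG : ∀ᵐ ω ∂μ, S s ω ∈ G) (htG : ∀ᵐ ω ∂μ, S t ω ∈ G)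
    (hY : IsIC μ Y) (hYs : ∀ᵐ ω ∂μ, Y s ω = g (S s ω)) (hYt : ∀ᵐ ω ∂μ, Y t ω = g (S t ω))
    {ζ : Fin d → ℝ × ℝ → ℝ} (hζ : ∀ i, IsDensityOf μ (fun ω => (S s ω i, S t ω i)) (ζ i))
    (hc : ContinuousOn (pairDensity ζ) (D ×ˢ D)) {x x' y y' : Fin d → ℝ}
    (hx : x ∈ D) (hx' : x' ∈ D) (hy : y ∈ D) (hy' : y' ∈ D)
    (hxy : ∀ k, g x k = g x' k ∨ g y k = g y' k) :
    pairDensity ζ (x, y) * pairDensity ζ (x', y') =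
      pairDensity ζ (x', y) * pairDensity ζ (x, y') := by
  have hopen : ∀ O ⊆ D, IsOpen O → IsOpen (g '' O) := fun O hO hOo =>
    hg.isOpen_image hOo (hO.trans hDG)
  obtain ⟨ψ, -, hψ⟩ := hg.2.2.2
  have hinj : InjOn g G := hψ.injOn
  have hgc : ContinuousOn g D := hg.2.2.1.continuousOn.mono hDG
  set E : (Fin d → ℝ) → ℝ → Set (Fin d → ℝ) := fun x ε => D ∩ g ⁻¹' Metric.ball (g x) ε with hE
  have hEo : ∀ x ε, IsOpen (E x ε) := fun x ε => hgc.isOpen_inter_preimage hDo Metric.isOpen_ball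
  have hEt : ∀ x ∈ D, Filter.Tendsto (E x) (nhdsWithin 0 (Ioi 0)) (nhds x).smallSets :=
    fun x hx => tendsto_inter_preimage_ball hopen hDo (hinj.mono hDG) hx
  set V : (Fin d → ℝ) → ℝ → ℝ := fun x ε => volume.real (E x ε) with hV
  have hVpos : ∀ x ∈ D, ∀ᶠ ε in nhdsWithin 0 (Ioi 0), 0 < V x ε := by
    intro x hx
    filter_upwards [Filter.tendsto_smallSets_iff.1 (hEt x hx) _
      (Metric.ball_mem_nhds x one_pos), self_mem_nhdsWithin] with ε h1 h2
    exact measureReal_pos_of_isOpen (hEo x ε) ⟨x, hx, Metric.mem_ball_self h2⟩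
      (measure_mono h1 |>.trans_lt measure_ball_lt_top).ne
  set M : (Fin d → ℝ) → (Fin d → ℝ) → ℝ → ℝ := fun x y ε =>
    μ.real {ω | S s ω ∈ E x ε ∧ S t ω ∈ E y ε} with hM
  -- The density is recovered as a limit of averages over `E x ε ×ˢ E y ε`, by continuity.
  have hlim : ∀ x ∈ D, ∀ y ∈ D, Filter.Tendsto (fun ε => M x y ε / (V x ε * V y ε))
      (nhdsWithin 0 (Ioi 0)) (nhds (pairDensity ζ (x, y))) := by
    intro x hx y hy
    have hts : Filter.Tendsto (fun ε => E x ε ×ˢ E y ε) (nhdsWithin 0 (Ioi 0))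
        (nhds (x, y)).smallSets := by
      rw [Filter.tendsto_smallSets_iff]
      intro U hU
      rw [nhds_prod_eq] at hU
      obtain ⟨U₁, hU₁, U₂, hU₂, hsub⟩ := Filter.mem_prod_iff.1 hU
      filter_upwards [Filter.tendsto_smallSets_iff.1 (hEt x hx) _ hU₁,
        Filter.tendsto_smallSets_iff.1 (hEt y hy) _ hU₂] with ε h1 h2
      exact (prod_mono h1 h2).trans hsub
    have ho := ContinuousAt.integral_sub_linear_isLittleO_ae (μ := volume)
      (hc.continuousAt ((hDo.prod hDo).mem_nhds ⟨hx, hy⟩))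
      ((measurable_pairDensity fun i => (hζ i).1).stronglyMeasurable.stronglyMeasurableAtFilter)
      hts (fun ε => V x ε * V y ε)
      (Filter.Eventually.of_forall fun ε => by
        simp only [hV, Measure.volume_eq_prod, measureReal_prod_prod])
    have h0 := ho.tendsto_div_nhds_zero.add_const (pairDensity ζ (x, y))
    rw [zero_add] at h0
    refine h0.congr' ?_
    filter_upwards [hVpos x hx, hVpos y hy] with ε h1 h2
    rw [← measureReal_eq_integral_pairDensity hS hs ht hζ (hEo x ε).measurableSet
      (hEo y ε).measurableSet, smul_eq_mul]
    have := (mul_pos h1 h2).ne'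
    rw [sub_div, mul_div_cancel_left₀ _ this, sub_add_cancel]
  have hball : ∀ x ∈ D, ∀ᶠ ε in nhdsWithin 0 (Ioi 0), Metric.ball (g x) ε ⊆ g '' D := by
    intro x hx
    obtain ⟨r, hr, hsub⟩ := Metric.isOpen_iff.1 (hopen D subset_rfl hDo) (g x)
      (mem_image_of_mem g hx)
    filter_upwards [Ioo_mem_nhdsGT hr] with ε hε
    exact (Metric.ball_subset_ball hε.2.le).trans hsub
  -- Once the balls lie in `g '' D`, the events for `S` and for `Y` agree almost surely, and the
  -- latter factor over the coordinates.
  have hprod : ∀ x ∈ D, ∀ y ∈ D, ∀ᶠ ε in nhdsWithin 0 (Ioi 0), M x y ε =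
      ∏ i, μ.real {ω | Y s ω i ∈ Metric.ball (g x i) ε ∧ Y t ω i ∈ Metric.ball (g y i) ε} := by
    intro x hx y hy
    filter_upwards [hball x hx, hball y hy, self_mem_nhdsWithin] with ε h1 h2 h3
    rw [← hY.measureReal_ball s t (g x) (g y) h3]
    have hiff : ∀ x, Metric.ball (g x) ε ⊆ g '' D → ∀ z ∈ G,
        (z ∈ E x ε ↔ g z ∈ Metric.ball (g x) ε) := by
      intro x hsub z hz
      refine ⟨fun h => h.2, fun h => ⟨?_, h⟩⟩
      obtain ⟨w, hw, hwz⟩ := hsub h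
      exact hinj (hDG hw) hz hwz ▸ hw
    refine measureReal_congr ?_
    filter_upwards [hsG, htG, hYs, hYt] with ω w1 w2 w3 w4
    refine propext ?_
    change (_ ∈ _ ∧ _ ∈ _) ↔ (_ ∈ _ ∧ _ ∈ _)
    rw [w3, w4, hiff x h1 _ w1, hiff y h2 _ w2]
  -- Both denominators are the product of the same four volumes. In the numerators the factor `k`
  -- sees only `g_k`, so exchanging `x` and `x'` is harmless if either alternative of `hxy` holds.
  have hcross : ∀ᶠ ε in nhdsWithin (0 : ℝ) (Ioi 0),
      M x y ε / (V x ε * V y ε) * (M x' y' ε / (V x' ε * V y' ε)) =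
        M x' y ε / (V x' ε * V y ε) * (M x y' ε / (V x ε * V y' ε)) := by
    filter_upwards [hprod x hx y hy, hprod x' hx' y' hy', hprod x' hx' y hy, hprod x hx y' hy']
      with ε h1 h2 h3 h4
    rw [div_mul_div_comm, div_mul_div_comm]
    congr 1
    · rw [h1, h2, h3, h4, ← Finset.prod_mul_distrib, ← Finset.prod_mul_distrib]
      refine Finset.prod_congr rfl fun k _ => ?_
      rcases hxy k with h | h <;> rw [h]
      exact mul_comm _ _
    · ring
  exact tendsto_nhds_unique (((hlim x hx y hy).mul (hlim x' hx' y' hy')).congr' hcross)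
    ((hlim x' hx' y hy).mul (hlim x hx y' hy'))

end

/-! ### From the cross-ratio identity to the Jacobian matrix -/

section
variable {d : ℕ} {g ψ : (Fin d → ℝ) → Fin d → ℝ} {G D : Set (Fin d → ℝ)}
  {ζ : Fin d → ℝ × ℝ → ℝ}

/-- The curve is `ψ (g x + a e_i)`: only the `i`-th coordinate of `g` moves, and the velocity is the
`i`-th column of the Jacobian matrix of `ψ`. -/
theorem exists_curve_of_leftInvOn (hg : IsInvertibleOn 1 g G) (hψ : ContDiffOn ℝ 1 ψ (g '' G))
    (hl : LeftInvOn ψ g G) (hDo : IsOpen D) (hDG : D ⊆ G) {x : Fin d → ℝ} (hx : x ∈ D)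
    (i : Fin d) : ∃ α : ℝ → Fin d → ℝ, α 0 = x ∧
      (∀ k, HasDerivAt (fun a => α a k) (jacobian ψ (g x) k i) 0) ∧
      ∀ᶠ a in nhds 0, α a ∈ D ∧ ∀ k ≠ i, g (α a) k = g x k := by
  have hline : HasDerivAt (fun a : ℝ => g x + a • Pi.single i (1 : ℝ)) (Pi.single i (1 : ℝ)) 0 := by
    simpa using ((hasDerivAt_id (0 : ℝ)).smul_const (Pi.single i (1 : ℝ))).const_add (g x)
  have h0 : g x + (0 : ℝ) • Pi.single i (1 : ℝ) = g x := by simp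
  have hd : HasFDerivAt ψ (fderiv ℝ ψ (g x)) (g x + (0 : ℝ) • Pi.single i (1 : ℝ)) := by
    rw [h0]
    exact ((hψ.contDiffAt (hg.2.1.mem_nhds (mem_image_of_mem g (hDG hx)))).differentiableAt
      one_ne_zero).hasFDerivAt
  refine ⟨fun a => ψ (g x + a • Pi.single i 1), by simp [hl (hDG hx)], fun k => ?_, ?_⟩
  · rw [jacobian_apply]
    exact hasDerivAt_pi.1 (hd.comp_hasDerivAt 0 hline) k
  · have hmem : g '' D ∈ nhds (g x + (0 : ℝ) • Pi.single i (1 : ℝ)) := by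
      rw [h0]
      exact (hg.isOpen_image hDo hDG).mem_nhds (mem_image_of_mem g hx)
    filter_upwards [hline.continuousAt hmem]
    rintro a ⟨z, hz, hza⟩
    have hza' : g x + a • Pi.single i (1 : ℝ) = g z := hza.symm
    rw [hza', hl (hDG hz)]
    refine ⟨hz, fun k hk => ?_⟩
    rw [← hza']
    simp [hk]

/-- The cross-ratio identity for the joint density makes `Bᵀ(x) Q(x, y) B(y)` diagonal, where `B` is
the Jacobian matrix of the inverse and `Q(x, y)` is the diagonal matrix of the mixed logarithmic
derivatives. -/
theorem isDiag_of_pairDensity_mul (hg : IsInvertibleOn 1 g G) (hψ : ContDiffOn ℝ 1 ψ (g '' G))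
    (hl : LeftInvOn ψ g G) (hDo : IsOpen D) (hDG : D ⊆ G) {U : Fin d → Set ℝ}
    (hU : ∀ k, IsOpen (U k)) (hDU : ∀ x ∈ D, ∀ k, x k ∈ U k)
    (hζ : ∀ k, ContDiffOn ℝ 2 (ζ k) (U k ×ˢ U k)) (hpos : ∀ k, ∀ p ∈ U k ×ˢ U k, 0 < ζ k p)
    (hcross : ∀ x ∈ D, ∀ x' ∈ D, ∀ y ∈ D, ∀ y' ∈ D, (∀ k, g x k = g x' k ∨ g y k = g y' k) →
      pairDensity ζ (x, y) * pairDensity ζ (x', y') =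
        pairDensity ζ (x', y) * pairDensity ζ (x, y'))
    {x y : Fin d → ℝ} (hx : x ∈ D) (hy : y ∈ D) :
    ((jacobian ψ (g x)).transpose * Matrix.diagonal (fun k => mixedLogDeriv (ζ k) (x k, y k)) *
      jacobian ψ (g y)).IsDiag := by
  intro i j hij
  have hUo : ∀ k, IsOpen (U k ×ˢ U k) := fun k => (hU k).prod (hU k)
  have hlog : ∀ x ∈ D, ∀ y ∈ D, Real.log (pairDensity ζ (x, y)) =
      ∑ k, Real.log (ζ k (x k, y k)) := fun x hx y hy =>
    Real.log_prod fun k _ => (hpos k _ ⟨hDU x hx k, hDU y hy k⟩).ne'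
  have hZ : ∀ x ∈ D, ∀ y ∈ D, pairDensity ζ (x, y) ≠ 0 := fun x hx y hy =>
    (Finset.prod_pos fun k _ => hpos k _ ⟨hDU x hx k, hDU y hy k⟩).ne'
  obtain ⟨α, hα0, hα, hαD⟩ := exists_curve_of_leftInvOn hg hψ hl hDo hDG hx i
  obtain ⟨β, hβ0, hβ, hβD⟩ := exists_curve_of_leftInvOn hg hψ hl hDo hDG hy j
  have hsnd : ∀ z ∈ D, HasDerivAt (fun b => ∑ k, Real.log (ζ k (z k, β b k)))
      (∑ k, logPartial (ζ k) (z k, y k) * jacobian ψ (g y) k j) 0 := by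
    intro z hz
    refine HasDerivAt.fun_sum fun k _ => ?_
    exact (hasDerivAt_log_snd (hUo k) (hζ k) (hpos k) (p := (z k, y k))
      ⟨hDU z hz k, hDU y hy k⟩).comp_of_eq 0 (hβ k) (by rw [hβ0])
  -- As `α` moves only `g_i`, `β` only `g_j`, and `i ≠ j`, the cross-ratio identity makes `log Z(α
  -- a, β b) - log Z(x, β b)` constant in `b` near `0`.
  have hconst : ∀ᶠ a in nhds 0, ∑ k, logPartial (ζ k) (α a k, y k) * jacobian ψ (g y) k j =
      ∑ k, logPartial (ζ k) (x k, y k) * jacobian ψ (g y) k j := by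
    filter_upwards [hαD] with a ha
    have h1 := (hsnd _ ha.1).sub (hsnd x hx)
    have h2 : HasDerivAt (fun b => (∑ k, Real.log (ζ k (α a k, β b k))) -
        ∑ k, Real.log (ζ k (x k, β b k))) 0 0 := by
      refine (hasDerivAt_const (0 : ℝ) (Real.log (pairDensity ζ (α a, y)) -
        Real.log (pairDensity ζ (x, y)))).congr_of_eventuallyEq ?_
      filter_upwards [hβD] with b hb
      have hc := hcross x hx (α a) ha.1 y hy (β b) hb.1 fun k => by
        by_cases hk : k = i
        · exact Or.inr (hb.2 k (hk ▸ hij)).symm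
        · exact Or.inl (ha.2 k hk).symm
      have hlc := congrArg Real.log hc
      rw [Real.log_mul (hZ x hx y hy) (hZ _ ha.1 _ hb.1),
        Real.log_mul (hZ _ ha.1 y hy) (hZ x hx _ hb.1)] at hlc
      rw [← hlog _ ha.1 _ hb.1, ← hlog x hx _ hb.1]
      linear_combination hlc
    exact sub_eq_zero.1 (h1.unique h2)
  have hfst : HasDerivAt (fun a => ∑ k, logPartial (ζ k) (α a k, y k) * jacobian ψ (g y) k j)
      (∑ k, mixedLogDeriv (ζ k) (x k, y k) * jacobian ψ (g x) k i * jacobian ψ (g y) k j) 0 := by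
    refine HasDerivAt.fun_sum fun k _ => HasDerivAt.mul_const ?_ _
    exact (hasDerivAt_logPartial (hUo k) (hζ k) (hpos k) (p := (x k, y k))
      ⟨hDU x hx k, hDU y hy k⟩).comp_of_eq 0 (hα k) (by rw [hα0])
  have hzero := hfst.unique ((hasDerivAt_const (0 : ℝ) _).congr_of_eventuallyEq hconst)
  rw [Matrix.mul_apply, ← hzero]
  refine Finset.sum_congr rfl fun k _ => ?_
  rw [Matrix.mul_diagonal, Matrix.transpose_apply]
  ring

/-- If the joint density of two pairs satisfies the cross-ratio identity, and its factors are
regularly non-separable and, with at most one exception, a.e. non-Gaussian, then each row of the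
Jacobian matrix has at most one nonzero entry at points arbitrarily close to any given one. -/
theorem exists_jacobian_mul_eq_zero (hg : IsInvertibleOn 1 g G) (hDo : IsOpen D) (hDG : D ⊆ G)
    (hζ : ∀ k, IsRegularlyNonSeparable (ζ k) ((fun u : Fin d → ℝ => u k) '' D))
    (hng : {k | ¬ AENotOn IsPseudoGaussianOn (ζ k)
      (((fun u : Fin d → ℝ => u k) '' D) ×ˢ ((fun u : Fin d → ℝ => u k) '' D))}.Subsingleton)
    (hcross : ∀ x ∈ D, ∀ x' ∈ D, ∀ y ∈ D, ∀ y' ∈ D, (∀ k, g x k = g x' k ∨ g y k = g y' k) →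
      pairDensity ζ (x, y) * pairDensity ζ (x', y') =
        pairDensity ζ (x', y) * pairDensity ζ (x, y'))
    {x₀ : Fin d → ℝ} (hx₀ : x₀ ∈ D) {N : Set (Fin d → ℝ)} (hN : N ∈ nhds x₀) :
    ∃ x ∈ D ∩ N, ∀ i j l, j ≠ l → jacobian g x i j * jacobian g x i l = 0 := by
  obtain ⟨δ, hδ, hsub⟩ := Metric.mem_nhds_iff.1 (Filter.inter_mem (hDo.mem_nhds hx₀) hN)
  have hU : ∀ k, IsOpen ((fun u : Fin d → ℝ => u k) '' D) := fun k => isOpenMap_eval k D hDo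
  choose W hWne hWinf hW using fun k =>
    (hζ k).exists_ratio_set (hU k) (mem_image_of_mem (fun u : Fin d → ℝ => u k) hx₀) hδ
  obtain ⟨w, hwinj, hw⟩ := exists_injective_mem W hWne fun k hk l hl =>
    hng (hWinf k hk) (hWinf l hl)
  choose x hx y hy hxx hyy hxy using fun k => hW k (w k) (hw k)
  -- The coordinates were chosen independently of each other; they assemble to points of `D ∩ N`
  -- because the sup-norm ball is a box.
  have hmem : ∀ x : Fin d → ℝ, (∀ k, x k ∈ Metric.ball (x₀ k) δ) → x ∈ D ∩ N := fun x h =>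
    hsub (by rw [ball_pi _ hδ]; exact fun k _ => h k)
  have hxD := hmem x hx
  have hyD := hmem y hy
  obtain ⟨ψ, hψ, hl⟩ := hg.2.2.2
  have hgc : ContDiffOn ℝ 1 g G := by exact_mod_cast hg.2.2.1
  have hψ : ContDiffOn ℝ 1 ψ (g '' G) := by exact_mod_cast hψ
  have hdiag : ∀ {x y : Fin d → ℝ}, x ∈ D → y ∈ D → _ := fun {x y} hx hy =>
    isDiag_of_pairDensity_mul hg hψ hl hDo hDG hU
      (fun x hx k => mem_image_of_mem (fun u : Fin d → ℝ => u k) hx)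
      (fun k => (hζ k).1) (fun k => (hζ k).2.1) hcross hx hy
  have hjac : ∀ {x : Fin d → ℝ}, x ∈ D → jacobian g x * jacobian ψ (g x) = 1 := fun hx =>
    jacobian_mul_jacobian_of_leftInvOn hg.1 hg.2.1 hgc hψ hl (hDG hx)
  refine ⟨x, hxD, fun i j l hjl => mul_eq_zero_of_isDiag (hjac hxD.1) (hjac hyD.1) hxx hyy
    (hdiag hxD.1 hxD.1) (hdiag hxD.1 hyD.1) (hdiag hyD.1 hyD.1) ?_ i hjl⟩
  intro k l hkl
  simp only [hxy] at hkl
  exact hwinj hkl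

end

/-! ### Identifiability -/

section
variable {Ω : Type*} [MeasurableSpace Ω] {μ : Measure Ω} {d : ℕ}
  {a b : ℝ} {S Y : Icc a b → Ω → Fin d → ℝ} {g : (Fin d → ℝ) → Fin d → ℝ} {G : Set (Fin d → ℝ)}

/-- The row condition holds at points arbitrarily near each point of `⋃ D_p`, which is dense in
`D_S`; continuity of the Jacobian matrix carries it to the closure. -/
theorem IsAlphaContrastive.jacobian_mul_eq_zero [IsProbabilityMeasure μ]
    (hS : IsAlphaContrastive μ S) (hg : IsInvertibleOn 1 g G) (hSG : spatialSupport μ S ⊆ G)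
    (hY : IsIC μ Y) (hYS : ∀ᵐ ω ∂μ, ∀ t, Y t ω = g (S t ω)) {x : Fin d → ℝ} (hx : x ∈ spatialSupport μ S)
    (i j l : Fin d) (hjl : j ≠ l) : jacobian g x i j * jacobian g x i l = 0 := by
  obtain ⟨hcp, hIC, P, D, hPD, hDS, hSD, hden⟩ := hS
  set A : Set (Fin d → ℝ) := {x | ∀ i j l, j ≠ l → jacobian g x i j * jacobian g x i l = 0}
  have hsub : (⋃ p ∈ P, D p) ⊆ closure A := by
    intro x₀ hx₀
    obtain ⟨p, hp, hxp⟩ := mem_iUnion₂.1 hx₀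
    obtain ⟨ζ, hζ, hng⟩ := hden p hp
    have hDo := (hPD p hp).2
    have hDG : D p ⊆ G := fun z hz => hSG (hDS (mem_iUnion₂.2 ⟨p, hp, hz⟩))
    have hae : ∀ t, ∀ᵐ ω ∂μ, S t ω ∈ G := fun t => by
      filter_upwards [ae_mem_spatialSupport (μ := μ) (hcp.measurable t)] with ω hω using hSG hω
    have hYt : ∀ t, ∀ᵐ ω ∂μ, Y t ω = g (S t ω) := fun t => by
      filter_upwards [hYS] with ω hω using hω t
    have hZ : ContinuousOn (pairDensity ζ) (D p ×ˢ D p) :=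
      continuousOn_finsetProd _ fun k _ => (hζ k).2.2.1.continuousOn.comp (by fun_prop)
        fun z hz => ⟨mem_image_of_mem (fun u : Fin d → ℝ => u k) hz.1,
          mem_image_of_mem (fun u : Fin d → ℝ => u k) hz.2⟩
    refine mem_closure_iff_nhds.2 fun N hN => ?_
    obtain ⟨z, hz, hzA⟩ := exists_jacobian_mul_eq_zero hg hDo hDG (fun k => (hζ k).2.2) hng
      (fun x hx x' hx' y hy y' hy' h => pairDensity_mul_pairDensity hg hDo hDG hIC
        (hcp.measurable p.1) (hcp.measurable p.2) (hae _) (hae _) hY (hYt _) (hYt _)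
        (fun k => (hζ k).1) hZ hx hx' hy hy' h) hxp hN
    exact ⟨z, hz.2, hzA⟩
  have hxA : x ∈ closure A := closure_minimal hsub isClosed_closure (hSD hx)
  have hgc : ContDiffOn ℝ 1 g G := by exact_mod_cast hg.2.2.1
  have hc : ContinuousAt (fun x => jacobian g x i j * jacobian g x i l) x :=
    ((continuousOn_jacobian hg.1 hgc i j).mul
      (continuousOn_jacobian hg.1 hgc i l)).continuousAt (hg.1.mem_nhds (hSG hx))
  have h0 := hc.continuousWithinAt.mem_closure_image hxA
  have himg : (fun x => jacobian g x i j * jacobian g x i l) '' A ⊆ {0} := by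
    rintro _ ⟨z, hz, rfl⟩
    exact hz i j l hjl
  have := closure_mono himg h0
  rwa [closure_singleton] at this

/-- Connectedness provides one permutation and one family of `h_i` for the whole support, so each
coordinate path of `Y` is almost surely a measurable function of a different coordinate path of `S`.
-/
theorem IsIC.of_isMonomialOn (hS : IsContinuousProcess S) (hIC : IsIC μ S)
    (hne : (spatialSupport μ S).Nonempty) (hconn : IsPreconnected (spatialSupport μ S))
    {ϱ : (Fin d → ℝ) → Fin d → ℝ} (hϱ : IsMonomialOn ϱ (spatialSupport μ S))
    (hYS : ∀ᵐ ω ∂μ, ∀ t, Y t ω = ϱ (S t ω)) : IsIC μ Y := by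
  classical
  obtain ⟨x, hx⟩ := hne
  obtain ⟨σ, h, hh, hϱh⟩ := hϱ x hx
  rw [hconn.connectedComponentIn hx] at hϱh hh
  set J : Fin d → Set ℝ := fun i => (fun y : Fin d → ℝ => y i) '' spatialSupport μ S
  have hJ : ∀ i, MeasurableSet (J i) := fun i =>
    (hconn.image _ (continuous_apply i).continuousOn).ordConnected.measurableSet
  -- `h i` is controlled only on the interval `J i`; the extension by `0` is measurable on `ℝ`.
  set k : Fin d → ℝ → ℝ := fun i => (J i).piecewise (h i) 0
  have hk : ∀ i, Measurable (k i) := fun i =>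
    (hh i).1.continuousOn.measurable_piecewise continuousOn_const (hJ i)
  have h1 : iIndepFun (fun (i : Fin d) (ω : Ω) (t : Icc a b) => k (σ i) (S t ω (σ i))) μ :=
    (iIndepFun.comp hIC (fun i x t => k i (x t)) fun i =>
      measurable_pi_lambda _ fun t => (hk i).comp (measurable_pi_apply t)).precomp σ.injective
  refine (iIndepFun_congr fun i => ?_).1 h1
  filter_upwards [hYS, hS.ae_forall_mem_spatialSupport (μ := μ)] with ω h2 h3
  funext t
  rw [h2 t, hϱh _ (h3 t)]
  exact piecewise_eq_of_mem _ _ _ (mem_image_of_mem (fun y : Fin d → ℝ => y (σ i)) (h3 t))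

theorem IsDiffeoOn.mono {E F : Type*} [NormedAddCommGroup E] [NormedSpace ℝ E]
    [NormedAddCommGroup F] [NormedSpace ℝ F] {k : ℕ} {φ : E → F} {A B : Set E}
    (h : IsDiffeoOn k φ B) (hAB : A ⊆ B) : IsDiffeoOn k φ A := by
  obtain ⟨h1, ψ, h2, h3⟩ := h
  exact ⟨h1.mono hAB, ψ, h2.mono (image_mono hAB), h3.mono hAB⟩

/-- Components of the smaller set lie in components of the larger one. This passes from `D_S` to the
trace of a path. -/
theorem IsMonomialOn.mono {ϱ : (Fin d → ℝ) → Fin d → ℝ} {A B : Set (Fin d → ℝ)}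
    (h : IsMonomialOn ϱ B) (hAB : A ⊆ B) : IsMonomialOn ϱ A := by
  intro x hx
  obtain ⟨σ, k, hk, hϱ⟩ := h x (hAB hx)
  have hC := connectedComponentIn_mono x hAB
  exact ⟨σ, k, fun i => (hk i).mono (image_mono hC), fun y hy => hϱ y (hC hy)⟩

theorem isMonomialOn_of_forall_connectedComponentIn {ϱ : (Fin d → ℝ) → Fin d → ℝ}
    {A : Set (Fin d → ℝ)} (h : ∀ x ∈ A, IsMonomialOn ϱ (connectedComponentIn A x)) :
    IsMonomialOn ϱ A := by
  intro x hx
  have hxC := mem_connectedComponentIn hx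
  have := h x hx x hxC
  rwa [isPreconnected_connectedComponentIn.connectedComponentIn hxC] at this

end

end NonlinearICA

/-! ### The main theorem -/

theorem mainTheorem1 {Ω : Type*} [MeasurableSpace Ω] (μ : Measure Ω) [IsProbabilityMeasure μ]
    (d : ℕ) (a b : ℝ) (hab : a ≤ b)
    (S X : Icc a b → Ω → Fin d → ℝ)
    (hS : NonlinearICA.IsAlphaContrastive μ S)
    (hX : NonlinearICA.IsContinuousProcess X)
    (f : (Fin d → ℝ) → Fin d → ℝ)
    (hf : ∃ G, NonlinearICA.spatialSupport μ S ⊆ G ∧ NonlinearICA.IsInvertibleOn 3 f G)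
    (hXS : ∀ᵐ ω ∂μ, ∀ t, X t ω = f (S t ω))
    (h : (Fin d → ℝ) → Fin d → ℝ)
    (hh : ∃ G, NonlinearICA.spatialSupport μ X ⊆ G ∧ NonlinearICA.IsInvertibleOn 3 h G) :
    -- the characterisation, for a convex spatial support
    (Convex ℝ (NonlinearICA.spatialSupport μ S) →
      ((∃ ϱ : (Fin d → ℝ) → Fin d → ℝ,
          NonlinearICA.IsMonomialOn ϱ (NonlinearICA.spatialSupport μ S) ∧
          ∀ᵐ ω ∂μ, ∀ t, h (X t ω) = ϱ (S t ω)) ↔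
        NonlinearICA.IsIC μ (fun t ω => h (X t ω)))) ∧
    -- from independence to the orbit, componentwise
    (NonlinearICA.IsIC μ (fun t ω => h (X t ω)) →
      (∀ C ⊆ NonlinearICA.spatialSupport μ S, Convex ℝ C →
        NonlinearICA.IsMonomialOn (h ∘ f) C) ∧
      ((∀ x ∈ NonlinearICA.spatialSupport μ S,
          Convex ℝ (connectedComponentIn (NonlinearICA.spatialSupport μ S) x)) →
        NonlinearICA.IsMonomialOn (h ∘ f) (NonlinearICA.spatialSupport μ S) ∧
        ∀ᵐ ω ∂μ, NonlinearICA.InMonomialOrbit (fun t => h (X t ω)) (fun t => S t ω))) ∧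
    -- from the orbit to independence, for a connected spatial support
    (IsPreconnected (NonlinearICA.spatialSupport μ S) →
      (∃ ϱ : (Fin d → ℝ) → Fin d → ℝ,
          NonlinearICA.IsMonomialOn ϱ (NonlinearICA.spatialSupport μ S) ∧
          ∀ᵐ ω ∂μ, ∀ t, h (X t ω) = ϱ (S t ω)) →
      NonlinearICA.IsIC μ (fun t ω => h (X t ω))) := by
  obtain ⟨F, hSF, hfF⟩ := hf
  obtain ⟨H, hXH, hhH⟩ := hh
  have hcp := hS.1
  have hg := (hfF.comp hhH).of_le (show 1 ≤ 3 by norm_num)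
  have hmaps := NonlinearICA.mapsTo_spatialSupport hfF.1 hfF.2.2.1.continuousOn hSF
    hcp.measurable hX.measurable hXS
  have hSG : NonlinearICA.spatialSupport μ S ⊆ F ∩ f ⁻¹' H := fun x hx =>
    ⟨hSF hx, hXH (hmaps hx)⟩
  have hYS : ∀ᵐ ω ∂μ, ∀ t, h (X t ω) = (h ∘ f) (S t ω) := by
    filter_upwards [hXS] with ω hω t
    rw [hω t, Function.comp_apply]
  -- The time interval is nonempty as `a ≤ b`, and `S_a` lies in the support almost surely.
  have hne : (NonlinearICA.spatialSupport μ S).Nonempty := by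
    obtain ⟨ω, hω⟩ := (NonlinearICA.ae_mem_spatialSupport (μ := μ)
      (hcp.measurable ⟨a, le_rfl, hab⟩)).exists
    exact ⟨_, hω⟩
  have hconv : NonlinearICA.IsIC μ (fun t ω => h (X t ω)) →
      ∀ C ⊆ NonlinearICA.spatialSupport μ S, Convex ℝ C →
        NonlinearICA.IsMonomialOn (h ∘ f) C := fun hY C hCS hC =>
    hg.isMonomialOn_of_convex hC (hCS.trans hSG) fun x hx =>
      hS.jacobian_mul_eq_zero hg hSG hY hYS (hCS hx)
  have horbit : IsPreconnected (NonlinearICA.spatialSupport μ S) →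
      (∃ ϱ : (Fin d → ℝ) → Fin d → ℝ,
          NonlinearICA.IsMonomialOn ϱ (NonlinearICA.spatialSupport μ S) ∧
          ∀ᵐ ω ∂μ, ∀ t, h (X t ω) = ϱ (S t ω)) →
      NonlinearICA.IsIC μ (fun t ω => h (X t ω)) := fun hconn ⟨_, hϱ, hYϱ⟩ =>
    NonlinearICA.IsIC.of_isMonomialOn hcp hS.2.1 hne hconn hϱ hYϱ
  refine ⟨fun hC => ⟨horbit hC.isPreconnected, fun hY => ⟨h ∘ f, hconv hY _ subset_rfl hC, hYS⟩⟩,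
    fun hY => ⟨hconv hY, fun hcomp => ?_⟩, horbit⟩
  have hmono := NonlinearICA.isMonomialOn_of_forall_connectedComponentIn fun x hx =>
    hconv hY _ (connectedComponentIn_subset _ x) (hcomp x hx)
  refine ⟨hmono, ?_⟩
  filter_upwards [hYS, hcp.ae_forall_mem_spatialSupport (μ := μ)] with ω h1 h2
  exact ⟨h ∘ f, hmono.mono (range_subset_iff.2 h2), h1⟩
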